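/- Let $M$ be a compact smooth $n$-manifold without boundary and let $(g(t),\Phi(t))$, $t\in[0,T)$, be a smooth solution on $M$ of List's extended Ricci flow $$\partial_t g_{ij}=-2R_{ij}+2\nabla_i\Phi\nabla_j\Phi,\qquad \partial_t\Phi=\Delta\Phi .$$ Put $S_{ij}=R_{ij}-\nabla_i\Phi\nabla_j\Phi$ and $S=g^{ij}S_{ij}=R-|\nabla\Phi|^2$. Let $a,B\in\mathbb R$, let $u:M\times[0,T)\to(0,\infty)$ be smooth, let $$F=-\Delta u+a\,u\log u+B\,S\,u ,$$ and assume $\partial_t u=-F$. Then for every $t\in[0,T)$ the time derivatives below exist (one-sided at $t=0$), all integrands below are integrable with respect to the Riemannian volume measure $d\mu$ of $g(t)$, and $$\begin{aligned}\int_M F^5\,\partial_tF\,d\mu={}&-5\int_M F^4|\nabla F|^2\,d\mu+10\int_M F^4\,\nabla_iF\,S^{ij}\,\nabla_ju\,d\mu+2\int_M F^5\,(\nabla_iS^{ij})\nabla_ju\,d\mu\\&-a\int_M F^6(\log u+1)\,d\mu-B\int_M F^6S\,d\mu+B\int_M F^5\,(\partial_tS)\,u\,d\mu\\&+\int_M F^5\,g^{ij}\,(\partial_t\Gamma^k_{ij})\,\nabla_ku\,d\mu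 ,\end{aligned}$$ where $\Gamma^k_{ij}$ are the Christoffel symbols of $g(t)$, and where the last integrand may be computed at each point $x$ in any local coordinates around $x$ that do not depend on time. If for every $x$ the coordinates used at $x$ satisfy $g^{ij}\Gamma^k_{ij}=0$ at $x$ at time $t$ (for example, if they are normal coordinates of $g(t)$ at $x$), then the last integral also equals $$\int_M F^5\,g^{ij}\left(\partial_t\Gamma^k_{ij}\,\nabla_ku-\Gamma^k_{ij}\,\nabla_kF\right)d\mu .$$ -/

import Mathlib

open Set MeasureTheory
open scoped Manifold ContDiff

noncomputable section

namespace ExtRicci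

/-- The model space `ℝⁿ`. -/
abbrev E (n : ℕ) := EuclideanSpace ℝ (Fin n)

/-- Charts of `M` with values in `ℝⁿ`. -/
abbrev Chart (n : ℕ) (M : Type*) [TopologicalSpace M] := OpenPartialHomeomorph M (E n)

/-- The smooth charts of `M`, that is, all local coordinate systems of the smooth structure. -/
abbrev smoothCharts (n : ℕ) (M : Type*) [TopologicalSpace M] [ChartedSpace (E n) M] :
    Set (Chart n M) :=
  IsManifold.maximalAtlas 𝓘(ℝ, E n) ∞ M

/-- Smooth Riemannian metrics on `M`. -/
abbrev Metric (n : ℕ) (M : Type*) [TopologicalSpace M] [ChartedSpace (E n) M]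
    [IsManifold 𝓘(ℝ, E n) ∞ M] :=
  Bundle.ContMDiffRiemannianMetric 𝓘(ℝ, E n) ∞ (E n)
    (fun x : M => TangentSpace 𝓘(ℝ, E n) x)

/-- `∂f/∂xⁱ` at `y`, for a function `f` on `ℝⁿ`. -/
def pd {n : ℕ} (i : Fin n) (f : E n → ℝ) (y : E n) : ℝ :=
  fderiv ℝ f y (EuclideanSpace.single i 1)

/-- The time derivative on `[0, T)` (one-sided at `0`). -/
def timeDeriv (T : ℝ) (f : ℝ → ℝ) (t : ℝ) : ℝ := derivWithin f (Ico 0 T) t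

/-- Smoothness on `[0, T) × M` of a time-dependent function on `M`. -/
def SmoothInSpacetime {n : ℕ} {M : Type*} [TopologicalSpace M] [ChartedSpace (E n) M]
    (T : ℝ) (f : ℝ → M → ℝ) : Prop :=
  ContMDiffOn (𝓘(ℝ, ℝ).prod 𝓘(ℝ, E n)) 𝓘(ℝ, ℝ) ∞
    (fun p : ℝ × M => f p.1 p.2) (Ico 0 T ×ˢ univ)

/-! ### Local expressions

In this section `φ` is a chart and `y` a point of its target; all quantities are the components
of the usual tensors in the coordinates given by `φ`, at the point with coordinates `y`. -/

section Local

variable {n : ℕ} {M : Type*} [TopologicalSpace M] [ChartedSpace (E n) M]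

/-- The coordinate vector `∂/∂xⁱ` of the chart `φ` at the point with coordinates `y`. -/
def coordVec (φ : Chart n M) (y : E n) (i : Fin n) : TangentSpace 𝓘(ℝ, E n) (φ.symm y) :=
  mfderiv 𝓘(ℝ, E n) 𝓘(ℝ, E n) φ.symm y
    (EuclideanSpace.single i (1 : ℝ) : E n)

/-- `∂f/∂xⁱ` in the chart `φ`, for a function `f` on `M`. -/
def cpd (φ : Chart n M) (i : Fin n) (f : M → ℝ) (y : E n) : ℝ :=
  pd i (fun z => f (φ.symm z)) y

variable [IsManifold 𝓘(ℝ, E n) ∞ M]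

/-- The components `g_{ij}` of the metric. -/
def gLow (g : Metric n M) (φ : Chart n M) (y : E n) : Matrix (Fin n) (Fin n) ℝ :=
  Matrix.of fun i j => g.inner (φ.symm y) (coordVec φ y i) (coordVec φ y j)

/-- The components `g^{ij}` of the inverse metric. -/
def gUp (g : Metric n M) (φ : Chart n M) (y : E n) : Matrix (Fin n) (Fin n) ℝ :=
  (gLow g φ y)⁻¹

/-- The Christoffel symbols `Γ^k_{ij}`; the arguments are in the order `k i j`. -/
def christoffel (g : Metric n M) (φ : Chart n M) (y : E n) (k i j : Fin n) : ℝ :=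
  (1 / 2) * ∑ l, gUp g φ y k l *
    (pd i (fun z => gLow g φ z j l) y + pd j (fun z => gLow g φ z i l) y
      - pd l (fun z => gLow g φ z i j) y)

/-- The Ricci tensor `R_{ij} = ∂_k Γ^k_{ij} - ∂_i Γ^k_{kj} + Γ^k_{kl} Γ^l_{ij} - Γ^k_{il} Γ^l_{kj}`
(positive on round spheres). -/
def ricci (g : Metric n M) (φ : Chart n M) (y : E n) (i j : Fin n) : ℝ :=
  ∑ k, (pd k (fun z => christoffel g φ z k i j) y - pd i (fun z => christoffel g φ z k k j) y)
    + ∑ k, ∑ l, (christoffel g φ y k k l * christoffel g φ y l i j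
        - christoffel g φ y k i l * christoffel g φ y l k j)

/-- The gradient `∇ⁱf = g^{ij} ∂_j f`. -/
def grad (g : Metric n M) (φ : Chart n M) (f : M → ℝ) (y : E n) (i : Fin n) : ℝ :=
  ∑ j, gUp g φ y i j * cpd φ j f y

/-- The divergence `∇_i Xⁱ = ∂_i Xⁱ + Γ^i_{ik} X^k` of a vector field with components `Xⁱ`. -/
def divVec (g : Metric n M) (φ : Chart n M) (X : E n → Fin n → ℝ) (y : E n) : ℝ :=
  ∑ i, pd i (fun z => X z i) y + ∑ i, ∑ k, christoffel g φ y i i k * X y k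

/-- The divergence `∇_i A^{ij} = ∂_i A^{ij} + Γ^i_{ik} A^{kj} + Γ^j_{ik} A^{ik}` of a contravariant
two-tensor with components `A^{ij}`. -/
def divTensor (g : Metric n M) (φ : Chart n M) (A : E n → Fin n → Fin n → ℝ) (y : E n)
    (j : Fin n) : ℝ :=
  ∑ i, pd i (fun z => A z i j) y
    + ∑ i, ∑ k, (christoffel g φ y i i k * A y k j + christoffel g φ y j i k * A y i k)

/-- `S_{ij} = R_{ij} - ∇_iΦ ∇_jΦ`. -/
def sLow (g : Metric n M) (Φ : M → ℝ) (φ : Chart n M) (y : E n) (i j : Fin n) : ℝ :=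
  ricci g φ y i j - cpd φ i Φ y * cpd φ j Φ y

/-- `S^{ij} = g^{ik} g^{jl} S_{kl}`. -/
def sUp (g : Metric n M) (Φ : M → ℝ) (φ : Chart n M) (y : E n) (i j : Fin n) : ℝ :=
  ∑ k, ∑ l, gUp g φ y i k * gUp g φ y j l * sLow g Φ φ y k l

end Local

/-! ### Functions on the manifold

The scalars below are evaluated at `x` in the preferred chart at `x`. -/

section Global

variable {n : ℕ} {M : Type*} [TopologicalSpace M] [ChartedSpace (E n) M]
  [IsManifold 𝓘(ℝ, E n) ∞ M]

/-- The Laplace-Beltrami operator `Δf = div (∇f)`. -/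
def laplacian (g : Metric n M) (f : M → ℝ) (x : M) : ℝ :=
  divVec g (chartAt (E n) x) (grad g (chartAt (E n) x) f) (chartAt (E n) x x)

/-- `S = tr_g S_{ij} = g^{ij} S_{ij}`. -/
def sTrace (g : Metric n M) (Φ : M → ℝ) (x : M) : ℝ :=
  ∑ i, ∑ j, gUp g (chartAt (E n) x) (chartAt (E n) x x) i j *
    sLow g Φ (chartAt (E n) x) (chartAt (E n) x x) i j

/-- `|∇f|² = ∇_i f ∇ⁱ f`. -/
def gradSq (g : Metric n M) (f : M → ℝ) (x : M) : ℝ :=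
  ∑ i, cpd (chartAt (E n) x) i f (chartAt (E n) x x) *
    grad g (chartAt (E n) x) f (chartAt (E n) x x) i

/-- `∇_i f S^{ij} ∇_j h`. -/
def sPair (g : Metric n M) (Φ f h : M → ℝ) (x : M) : ℝ :=
  ∑ i, ∑ j, cpd (chartAt (E n) x) i f (chartAt (E n) x x) *
    sUp g Φ (chartAt (E n) x) (chartAt (E n) x x) i j *
    cpd (chartAt (E n) x) j h (chartAt (E n) x x)

/-- `(∇_i S^{ij}) ∇_j h`. -/
def divSPair (g : Metric n M) (Φ h : M → ℝ) (x : M) : ℝ :=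
  ∑ j, divTensor g (chartAt (E n) x) (sUp g Φ (chartAt (E n) x)) (chartAt (E n) x x) j *
    cpd (chartAt (E n) x) j h (chartAt (E n) x x)

/-- `F = -Δu + a u log u + B S u`. -/
def bigF (g : ℝ → Metric n M) (Φ u : ℝ → M → ℝ) (a B : ℝ) (t : ℝ) (x : M) : ℝ :=
  -laplacian (g t) (u t) x + a * u t x * Real.log (u t x) + B * sTrace (g t) (Φ t) x * u t x

/-- `g^{ij} (∂_t Γ^k_{ij}) ∇_k u` at time `t` and at the point with coordinates `y` in `φ`. -/
def dotChristoffelTerm (T : ℝ) (g : ℝ → Metric n M) (φ : Chart n M) (h : M → ℝ) (t : ℝ)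
    (y : E n) : ℝ :=
  ∑ i, ∑ j, gUp (g t) φ y i j *
    ∑ k, timeDeriv T (fun s => christoffel (g s) φ y k i j) t * cpd φ k h y

/-- `g^{ij} (∂_t Γ^k_{ij} ∇_k u - Γ^k_{ij} ∇_k f)` at time `t` and at the point with
coordinates `y` in `φ`. -/
def fullChristoffelTerm (T : ℝ) (g : ℝ → Metric n M) (φ : Chart n M) (h f : M → ℝ) (t : ℝ)
    (y : E n) : ℝ :=
  ∑ i, ∑ j, gUp (g t) φ y i j *
    ∑ k, (timeDeriv T (fun s => christoffel (g s) φ y k i j) t * cpd φ k h y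
      - christoffel (g t) φ y k i j * cpd φ k f y)

/-- List's extended Ricci flow on `[0, T)`: `g` and `Φ` are smooth in space and time,
`∂_t g_{ij} = -2 R_{ij} + 2 ∇_iΦ ∇_jΦ` in all local coordinates, and `∂_t Φ = ΔΦ`. -/
structure IsExtendedRicciFlow (T : ℝ) (g : ℝ → Metric n M) (Φ : ℝ → M → ℝ) : Prop where
  smooth_metric : ∀ φ ∈ smoothCharts n M, ∀ i j : Fin n,
    ContDiffOn ℝ ∞ (fun p : ℝ × E n => gLow (g p.1) φ p.2 i j) (Ico 0 T ×ˢ φ.target)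
  smooth_scalar : SmoothInSpacetime (n := n) T Φ
  metric_eq : ∀ t ∈ Ico 0 T, ∀ φ ∈ smoothCharts n M, ∀ y ∈ φ.target, ∀ i j : Fin n,
    timeDeriv T (fun s => gLow (g s) φ y i j) t =
      -2 * ricci (g t) φ y i j + 2 * cpd φ i (Φ t) y * cpd φ j (Φ t) y
  scalar_eq : ∀ t ∈ Ico 0 T, ∀ x : M, timeDeriv T (fun s => Φ s x) t = laplacian (g t) (Φ t) x

/-- The measure `√(det g_{ij}) dx¹ ⋯ dxⁿ` on the domain of the chart `φ`, extended by zero. -/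
def chartMeasure [MeasurableSpace M] (g : Metric n M) (φ : Chart n M) : Measure M :=
  Measure.map φ.symm ((volume.restrict φ.target).withDensity
    fun y => ENNReal.ofReal (Real.sqrt (gLow g φ y).det))

/-- The Riemannian volume measure. The measures `chartMeasure g φ` agree on the overlaps of the
chart domains, so the least measure above all of them is the one that restricts to
`√(det g_{ij}) dx¹ ⋯ dxⁿ` in every chart. -/
def volumeMeasure [MeasurableSpace M] (g : Metric n M) : Measure M :=
  ⨆ φ ∈ smoothCharts n M, chartMeasure g φ

end Global

end ExtRicci

end

/-!
The identity is a pointwise evolution equation for `F`, integrated against `F ^ 5`. In coordinates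
which do not depend on time, `∂_t g^{ij} = 2 S^{ij}` and `∂_t u = -F` give
`∂_t (Δu) = 2 S^{ij} ∇_i ∇_j u - ΔF - g^{ij} (∂_t Γ^k_{ij}) ∇_k u`, hence
`∂_t F = ΔF - 2 S^{ij} ∇_i ∇_j u + g^{ij} (∂_t Γ^k_{ij}) ∇_k u - a F (log u + 1) + B (∂_t S) u - B S F`
(`IsExtendedRicciFlow.timeDeriv_bigF`). Multiplied by `F ^ 5`, the first two terms are integrated by
parts, the second one after writing
`S^{ij} ∇_i ∇_j u = ∇_i (S^{ij} ∇_j u) - (∇_i S^{ij}) ∇_j u`. The smoothness of all quantities in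
space and time, up to the initial time, justifies exchanging time and space derivatives
(`timeDeriv_pd_comm`), and gives integrability, as `M` is compact.

The work lies in the passage from coordinates to the manifold.

* All scalars in the evolution equation except the last integrand are shown to be independent of the
  chart; then so is the last integrand, by the equation itself. The metric transforms as a tensor
  (`gLow_transition`). So does `S_{ij}`, because `∂_t g_{ij} = -2 S_{ij}` in every chart
  (`isCovTensor_sLow`); the curvature tensor need not be transformed. The transformation law of the
  Christoffel symbols (`jac_mul_connMat`) follows from the uniqueness of the torsion-free
  connection compatible with the metric, and implies that Hessians are tensors and that divergences
  of vector fields are functions (`isCovTensor_hessMat`, `IsVector.isScalar_divVec`).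
* In the domain of a chart the volume measure is `√(det g) dx` (`volumeMeasure_restrict_source`), by
  the change of variables formula.
* The divergence theorem (`integral_divVec_eq_zero`) is reduced by a partition of unity to vector
  fields supported in a chart, where `√(det g) div X = ∂_i (√(det g) Xⁱ)` by Jacobi's formula.
-/

noncomputable section

namespace ExtRicci

/-! ### Partial derivatives on the model space -/

lemma two_le_minSmoothness : minSmoothness ℝ 2 ≤ (∞ : WithTop ℕ∞) := by
  rw [minSmoothness_of_isRCLikeNormedField]
  exact WithTop.coe_le_coe.2 le_top

section PartialDerivatives

variable {n : ℕ} {f h : E n → ℝ} {y : E n} (i : Fin n)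

lemma pd_congr (H : f =ᶠ[nhds y] h) : pd i f y = pd i h y := by
  simp only [pd, H.fderiv_eq]

lemma pd_congr_of_eqOn {U : Set (E n)} (hU : IsOpen U) (hy : y ∈ U) (H : EqOn f h U) :
    pd i f y = pd i h y :=
  pd_congr i (H.eventuallyEq_of_mem (hU.mem_nhds hy))

lemma pd_const (c : ℝ) : pd i (fun _ => c) y = 0 := by simp [pd]

lemma pd_neg : pd i (fun z => -f z) y = -pd i f y := by
  simp [pd, fderiv_fun_neg]

lemma pd_mul (hf : DifferentiableAt ℝ f y) (hh : DifferentiableAt ℝ h y) :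
    pd i (fun z => f z * h z) y = pd i f y * h y + f y * pd i h y := by
  simp [pd, fderiv_fun_mul hf hh]; ring

lemma pd_pow (hf : DifferentiableAt ℝ f y) (m : ℕ) :
    pd i (fun z => f z ^ m) y = m * f y ^ (m - 1) * pd i f y := by
  simp [pd, fderiv_fun_pow m hf]

lemma pd_sum {ι : Type*} {s : Finset ι} {f : ι → E n → ℝ}
    (hf : ∀ a ∈ s, DifferentiableAt ℝ (f a) y) :
    pd i (fun z => ∑ a ∈ s, f a z) y = ∑ a ∈ s, pd i (f a) y := by
  simp [pd, fderiv_fun_sum hf]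

lemma fderiv_apply_eq_sum_pd (v : E n) : fderiv ℝ f y v = ∑ c, v c * pd c f y := by
  conv_lhs => rw [← (EuclideanSpace.basisFun (Fin n) ℝ).sum_repr v]
  simp [pd]

/-- The chain rule in coordinates. -/
lemma pd_comp {m : ℕ} {f : E m → ℝ} {τ : E n → E m} (hf : DifferentiableAt ℝ f (τ y))
    (hτ : DifferentiableAt ℝ τ y) :
    pd i (fun z => f (τ z)) y = ∑ c, pd i (fun z => τ z c) y * pd c f (τ y) := by
  have h1 : fderiv ℝ (fun z => f (τ z)) y = (fderiv ℝ f (τ y)).comp (fderiv ℝ τ y) :=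
    (hf.hasFDerivAt.comp y hτ.hasFDerivAt).fderiv
  have h2 (c : Fin m) : pd i (fun z => τ z c) y = fderiv ℝ τ y (EuclideanSpace.single i 1) c := by
    have := ((EuclideanSpace.proj (𝕜 := ℝ) c).hasFDerivAt.comp y hτ.hasFDerivAt).fderiv
    simp only [pd]
    exact congrArg (fun L => L (EuclideanSpace.single i (1 : ℝ))) this
  simp only [h2, ← fderiv_apply_eq_sum_pd]
  simp only [pd, h1, ContinuousLinearMap.comp_apply]

variable {U : Set (E n)}

lemma contDiffOn_pd (hU : IsOpen U) (hf : ContDiffOn ℝ ∞ f U) : ContDiffOn ℝ ∞ (pd i f) U :=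
  (hf.fderiv_of_isOpen hU le_rfl).clm_apply contDiffOn_const

lemma differentiableAt_of_contDiffOn (hU : IsOpen U) (hf : ContDiffOn ℝ ∞ f U) (hy : y ∈ U) :
    DifferentiableAt ℝ f y :=
  (hf.contDiffAt (hU.mem_nhds hy)).differentiableAt (by simp)

lemma pd_pd_comm (hU : IsOpen U) (hf : ContDiffOn ℝ ∞ f U) (hy : y ∈ U) (i j : Fin n) :
    pd i (pd j f) y = pd j (pd i f) y := by
  have hd : DifferentiableAt ℝ (fderiv ℝ f) y :=
    ((hf.fderiv_of_isOpen hU (m := ∞) le_rfl).contDiffAt (hU.mem_nhds hy)).differentiableAt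
      (by simp)
  have key (i j : Fin n) : pd i (pd j f) y =
      fderiv ℝ (fderiv ℝ f) y (EuclideanSpace.single i 1) (EuclideanSpace.single j 1) := by
    have := (hd.hasFDerivAt.clm_apply (hasFDerivAt_const (EuclideanSpace.single j (1 : ℝ)) y)).fderiv
    change fderiv ℝ (fun z => fderiv ℝ f z (EuclideanSpace.single j 1)) y _ = _
    rw [this]
    simp
  rw [key, key]
  exact (hf.contDiffAt (hU.mem_nhds hy)).isSymmSndFDerivAt two_le_minSmoothness _ _

end PartialDerivatives

/-! ### Functions of time and space on a half-open time interval -/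

section Spacetime

variable {n : ℕ} {T : ℝ} {U : Set (E n)}

lemma uniqueDiffOn_spacetime (hU : IsOpen U) : UniqueDiffOn ℝ (Ico 0 T ×ˢ U) :=
  (uniqueDiffOn_Ico 0 T).prod hU.uniqueDiffOn

lemma mem_closure_interior_spacetime (hU : IsOpen U) {p : ℝ × E n} (hp : p ∈ Ico 0 T ×ˢ U) :
    p ∈ closure (interior (Ico 0 T ×ˢ U)) := by
  have hT : (0 : ℝ) ≠ T := (hp.1.1.trans_lt hp.1.2).ne
  rw [interior_prod_eq, closure_prod_eq, interior_Ico, hU.interior_eq, closure_Ioo hT]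
  exact ⟨⟨hp.1.1, hp.1.2.le⟩, subset_closure hp.2⟩

lemma timeDeriv_congr {f h : ℝ → ℝ} (H : EqOn f h (Ico 0 T)) {t : ℝ} (ht : t ∈ Ico 0 T) :
    timeDeriv T f t = timeDeriv T h t :=
  derivWithin_congr H (H ht)

lemma timeDeriv_eq_of_hasDerivWithinAt {f : ℝ → ℝ} {f' t : ℝ} (ht : t ∈ Ico 0 T)
    (h : HasDerivWithinAt f f' (Ico 0 T) t) : timeDeriv T f t = f' :=
  h.derivWithin (uniqueDiffOn_Ico 0 T t ht)

/-- Smoothness on `[0, T) × U`, for an open subset `U` of the model space. -/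
def SmoothOnCylinder (T : ℝ) (U : Set (E n)) (f : ℝ → E n → ℝ) : Prop :=
  ContDiffOn ℝ ∞ (fun p : ℝ × E n => f p.1 p.2) (Ico 0 T ×ˢ U)

variable {f : ℝ → E n → ℝ}

lemma hasFDerivWithinAt_spacetime (hf : SmoothOnCylinder T U f)
    {t : ℝ} (ht : t ∈ Ico 0 T) {y : E n} (hy : y ∈ U) :
    HasFDerivWithinAt (fun p : ℝ × E n => f p.1 p.2)
      (fderivWithin ℝ (fun p : ℝ × E n => f p.1 p.2) (Ico 0 T ×ˢ U) (t, y))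
      (Ico 0 T ×ˢ U) (t, y) :=
  ((hf (t, y) ⟨ht, hy⟩).differentiableWithinAt (by simp)).hasFDerivWithinAt

lemma pd_eq_fderivWithin (hU : IsOpen U)
    (hf : SmoothOnCylinder T U f)
    {t : ℝ} (ht : t ∈ Ico 0 T) {y : E n} (hy : y ∈ U) (i : Fin n) :
    pd i (f t) y = fderivWithin ℝ (fun p : ℝ × E n => f p.1 p.2) (Ico 0 T ×ˢ U) (t, y)
      (0, EuclideanSpace.single i 1) := by
  have h1 : HasFDerivAt (fun z : E n => (t, z)) (ContinuousLinearMap.inr ℝ ℝ (E n)) y :=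
    hasFDerivAt_prodMk_right t y
  have h2 : HasFDerivWithinAt (f t) _ U y :=
    (hasFDerivWithinAt_spacetime hf ht hy).comp y h1.hasFDerivWithinAt
      (fun z hz => ⟨ht, hz⟩)
  have h3 := (h2.hasFDerivAt (hU.mem_nhds hy)).fderiv
  simp only [pd, h3]
  simp

lemma hasDerivWithinAt_spacetime
    (hf : SmoothOnCylinder T U f)
    {t : ℝ} (ht : t ∈ Ico 0 T) {y : E n} (hy : y ∈ U) :
    HasDerivWithinAt (fun s => f s y)
      (fderivWithin ℝ (fun p : ℝ × E n => f p.1 p.2) (Ico 0 T ×ˢ U) (t, y) (1, 0))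
      (Ico 0 T) t := by
  have h1 : HasFDerivAt (fun s : ℝ => (s, y)) (ContinuousLinearMap.inl ℝ ℝ (E n)) t :=
    hasFDerivAt_prodMk_left t y
  have hm : MapsTo (fun s : ℝ => (s, y)) (Ico 0 T) (Ico 0 T ×ˢ U) := fun s hs => ⟨hs, hy⟩
  have h2 := ((hasFDerivWithinAt_spacetime hf ht hy).comp t h1.hasFDerivWithinAt hm).hasDerivWithinAt
  rw [ContinuousLinearMap.comp_apply, ContinuousLinearMap.inl_apply] at h2
  exact h2

lemma differentiableWithinAt_time
    (hf : SmoothOnCylinder T U f)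
    {t : ℝ} (ht : t ∈ Ico 0 T) {y : E n} (hy : y ∈ U) :
    DifferentiableWithinAt ℝ (fun s => f s y) (Ico 0 T) t :=
  (hasDerivWithinAt_spacetime hf ht hy).differentiableWithinAt

lemma timeDeriv_eq_fderivWithin
    (hf : SmoothOnCylinder T U f)
    {t : ℝ} (ht : t ∈ Ico 0 T) {y : E n} (hy : y ∈ U) :
    timeDeriv T (fun s => f s y) t =
      fderivWithin ℝ (fun p : ℝ × E n => f p.1 p.2) (Ico 0 T ×ˢ U) (t, y) (1, 0) :=
  timeDeriv_eq_of_hasDerivWithinAt ht (hasDerivWithinAt_spacetime hf ht hy)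

lemma SmoothOnCylinder.pd (hU : IsOpen U)
    (hf : SmoothOnCylinder T U f) (i : Fin n) :
    SmoothOnCylinder T U fun s y => pd i (f s) y :=
  ((ContDiffOn.fderivWithin hf (uniqueDiffOn_spacetime hU) (m := ∞) le_rfl).clm_apply
    contDiffOn_const).congr fun _ hp => pd_eq_fderivWithin hU hf hp.1 hp.2 i

lemma SmoothOnCylinder.timeDeriv (hU : IsOpen U)
    (hf : SmoothOnCylinder T U f) :
    SmoothOnCylinder T U fun t y => timeDeriv T (fun s => f s y) t :=
  ((ContDiffOn.fderivWithin hf (uniqueDiffOn_spacetime hU) (m := ∞) le_rfl).clm_apply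
    contDiffOn_const).congr fun _ hp => timeDeriv_eq_fderivWithin hf hp.1 hp.2

/-- Time and space derivatives commute, also at the initial time, where the time derivative is
one-sided. -/
lemma timeDeriv_pd_comm (hU : IsOpen U)
    (hf : SmoothOnCylinder T U f)
    {t : ℝ} (ht : t ∈ Ico 0 T) {y : E n} (hy : y ∈ U) (i : Fin n) :
    timeDeriv T (fun s => pd i (f s) y) t = pd i (fun z => timeDeriv T (fun s => f s z) t) y := by
  set Q := Ico 0 T ×ˢ U
  set D := fderivWithin ℝ (fun p : ℝ × E n => f p.1 p.2) Q with hD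
  have hQ : UniqueDiffOn ℝ Q := uniqueDiffOn_spacetime hU
  have hp : (t, y) ∈ Q := ⟨ht, hy⟩
  have hDs : ContDiffOn ℝ ∞ D Q := ContDiffOn.fderivWithin hf hQ le_rfl
  have hDd : HasFDerivWithinAt D (fderivWithin ℝ D Q (t, y)) Q (t, y) :=
    ((hDs _ hp).differentiableWithinAt (by simp)).hasFDerivWithinAt
  have key (v w : ℝ × E n) :
      fderivWithin ℝ (fun p => D p v) Q (t, y) w = fderivWithin ℝ D Q (t, y) w v := by
    rw [(hDd.clm_apply (hasFDerivWithinAt_const v _ _)).fderivWithin (hQ _ hp)]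
    simp
  have hsm (v : ℝ × E n) : ContDiffOn ℝ ∞ (fun p : ℝ × E n => D (p.1, p.2) v) Q :=
    hDs.clm_apply contDiffOn_const
  have hL : timeDeriv T (fun s => pd i (f s) y) t = fderivWithin ℝ D Q (t, y) (1, 0)
      (0, EuclideanSpace.single i 1) := by
    rw [timeDeriv_congr (h := fun s => D (s, y) (0, EuclideanSpace.single i 1))
      (fun s hs => pd_eq_fderivWithin hU hf hs hy i) ht,
      timeDeriv_eq_fderivWithin (f := fun s z => D (s, z) (0, EuclideanSpace.single i 1))
        (hsm _) ht hy]
    exact key _ _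
  have hR : pd i (fun z => timeDeriv T (fun s => f s z) t) y = fderivWithin ℝ D Q (t, y)
      (0, EuclideanSpace.single i 1) (1, 0) := by
    rw [pd_congr_of_eqOn i hU hy (h := fun z => D (t, z) (1, 0))
      (fun z hz => timeDeriv_eq_fderivWithin hf ht hz),
      pd_eq_fderivWithin (f := fun s z => D (s, z) (1, 0)) hU (hsm _) ht hy]
    exact key _ _
  rw [hL, hR]
  exact (hf _ hp).isSymmSndFDerivWithinAt two_le_minSmoothness hQ (mem_closure_interior_spacetime hU hp) hp _ _

/-- The restriction to a fixed time of a function which is smooth in space and time. -/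
lemma SmoothOnCylinder.slice (hf : SmoothOnCylinder T U f)
    {t : ℝ} (ht : t ∈ Ico 0 T) : ContDiffOn ℝ ∞ (f t) U :=
  hf.comp (contDiffOn_const.prodMk contDiffOn_id) fun _ hz => ⟨ht, hz⟩

end Spacetime

/-! ### Derivatives of matrix-valued functions -/

section MatrixCalculus

lemma contDiffOn_det {V ι : Type*} [NormedAddCommGroup V] [NormedSpace ℝ V] [Fintype ι]
    [DecidableEq ι] {A : V → Matrix ι ι ℝ} {s : Set V}
    (hA : ∀ i j, ContDiffOn ℝ ∞ (fun z => A z i j) s) :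
    ContDiffOn ℝ ∞ (fun z => (A z).det) s := by
  simp only [Matrix.det_apply]
  exact ContDiffOn.sum fun σ _ => (contDiffOn_prod fun i _ => hA _ _).const_smul _

lemma contDiffOn_inv_apply {V ι : Type*} [NormedAddCommGroup V] [NormedSpace ℝ V] [Fintype ι]
    [DecidableEq ι] {A : V → Matrix ι ι ℝ} {s : Set V}
    (hA : ∀ i j, ContDiffOn ℝ ∞ (fun z => A z i j) s) (hdet : ∀ z ∈ s, (A z).det ≠ 0) (i j : ι) :
    ContDiffOn ℝ ∞ (fun z => (A z)⁻¹ i j) s := by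
  simp only [Matrix.inv_def, Ring.inverse_eq_inv', Matrix.smul_apply, smul_eq_mul,
    Matrix.adjugate_apply]
  refine ((contDiffOn_det hA).inv hdet).mul (contDiffOn_det fun k l => ?_)
  by_cases hk : k = j
  · subst hk; simp only [Matrix.updateRow_self]; exact contDiffOn_const
  · simp only [Matrix.updateRow_ne hk]; exact hA k l

variable {n : ℕ}

/-- The entrywise partial derivative of a matrix-valued function. -/
def pdMat {ι κ : Type*} (k : Fin n) (A : E n → Matrix ι κ ℝ) (y : E n) : Matrix ι κ ℝ :=
  Matrix.of fun i j => pd k (fun z => A z i j) y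

/-- The entrywise time derivative of a matrix-valued function. -/
def timeDerivMat {ι κ : Type*} (T : ℝ) (A : ℝ → Matrix ι κ ℝ) (t : ℝ) : Matrix ι κ ℝ :=
  Matrix.of fun i j => timeDeriv T (fun s => A s i j) t

variable {ι κ ν : Type*}

lemma pdMat_mul [Fintype κ] {A : E n → Matrix ι κ ℝ} {B : E n → Matrix κ ν ℝ} {y : E n}
    (hA : ∀ i j, DifferentiableAt ℝ (fun z => A z i j) y)
    (hB : ∀ i j, DifferentiableAt ℝ (fun z => B z i j) y) (k : Fin n) :
    pdMat k (fun z => A z * B z) y = pdMat k A y * B y + A y * pdMat k B y := by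
  ext i j
  simp only [pdMat, Matrix.of_apply, Matrix.add_apply, Matrix.mul_apply, ← Finset.sum_add_distrib]
  refine (pd_sum (f := fun a z => A z i a * B z a j) k fun a _ => (hA i a).mul (hB a j)).trans ?_
  exact Finset.sum_congr rfl fun a _ => pd_mul k (hA i a) (hB a j)

lemma differentiableAt_mul_apply [Fintype κ] {A : E n → Matrix ι κ ℝ} {B : E n → Matrix κ ν ℝ} {y : E n}
    (hA : ∀ i j, DifferentiableAt ℝ (fun z => A z i j) y)
    (hB : ∀ i j, DifferentiableAt ℝ (fun z => B z i j) y) (i : ι) (j : ν) :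
    DifferentiableAt ℝ (fun z => (A z * B z) i j) y := by
  simp only [Matrix.mul_apply]
  exact DifferentiableAt.fun_sum fun a _ => (hA i a).mul (hB a j)

lemma pdMat_transpose (A : E n → Matrix ι κ ℝ) (y : E n) (k : Fin n) :
    pdMat k (fun z => (A z).transpose) y = (pdMat k A y).transpose := rfl

lemma pdMat_congr {A B : E n → Matrix ι κ ℝ} {U : Set (E n)} (hU : IsOpen U) {y : E n}
    (hy : y ∈ U) (H : EqOn A B U) (k : Fin n) : pdMat k A y = pdMat k B y := by
  ext i j
  exact pd_congr_of_eqOn k hU hy fun z hz => by rw [H hz]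

lemma timeDerivMat_mul [Fintype κ] {T t : ℝ} (ht : t ∈ Ico 0 T) {A : ℝ → Matrix ι κ ℝ} {B : ℝ → Matrix κ ν ℝ}
    (hA : ∀ i j, DifferentiableWithinAt ℝ (fun s => A s i j) (Ico 0 T) t)
    (hB : ∀ i j, DifferentiableWithinAt ℝ (fun s => B s i j) (Ico 0 T) t) :
    timeDerivMat T (fun s => A s * B s) t =
      timeDerivMat T A t * B t + A t * timeDerivMat T B t := by
  ext i j
  simp only [timeDerivMat, Matrix.of_apply, Matrix.add_apply, Matrix.mul_apply,
    ← Finset.sum_add_distrib]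
  exact timeDeriv_eq_of_hasDerivWithinAt ht (HasDerivWithinAt.fun_sum fun a _ =>
    (hA i a).hasDerivWithinAt.mul (hB a j).hasDerivWithinAt)

lemma pdMat_const (C : Matrix ι κ ℝ) (y : E n) (k : Fin n) : pdMat k (fun _ => C) y = 0 := by
  ext i j; exact pd_const k _

variable [Fintype ι] [DecidableEq ι]

lemma pdMat_inv {A : E n → Matrix ι ι ℝ} {U : Set (E n)} (hU : IsOpen U)
    (hA : ∀ i j, ContDiffOn ℝ ∞ (fun z => A z i j) U) (hdet : ∀ z ∈ U, (A z).det ≠ 0)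
    {y : E n} (hy : y ∈ U) (k : Fin n) :
    pdMat k (fun z => (A z)⁻¹) y = -((A y)⁻¹ * pdMat k A y * (A y)⁻¹) := by
  have h1 : pdMat k (fun z => (A z)⁻¹ * A z) y = 0 := by
    rw [pdMat_congr hU hy (B := fun _ => 1)
      (fun z hz => Matrix.nonsing_inv_mul _ (hdet z hz).isUnit), pdMat_const]
  rw [pdMat_mul (fun i j => differentiableAt_of_contDiffOn hU (contDiffOn_inv_apply hA hdet i j) hy)
    (fun i j => differentiableAt_of_contDiffOn hU (hA i j) hy)] at h1
  have h2 := congrArg (· * (A y)⁻¹) (eq_neg_of_add_eq_zero_left h1)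
  simpa [Matrix.mul_assoc, Matrix.mul_nonsing_inv _ (hdet y hy).isUnit] using h2

/-- **Jacobi's formula** for the derivative of a determinant. -/
lemma pd_det {A : E n → Matrix ι ι ℝ} {y : E n}
    (hA : ∀ i j, DifferentiableAt ℝ (fun z => A z i j) y) (hdet : (A y).det ≠ 0) (k : Fin n) :
    pd k (fun z => (A z).det) y = (A y).det * ((A y)⁻¹ * pdMat k A y).trace := by
  have h1 : pd k (fun z => (A z).det) y = ∑ i, ((A y).updateCol i (fun a => pdMat k A y a i)).det := by
    simp only [Matrix.det_apply]
    have hprod (σ : Equiv.Perm ι) : DifferentiableAt ℝ (fun z => ∏ i, A z (σ i) i) y :=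
      (HasFDerivAt.finsetProd fun i _ => (hA (σ i) i).hasFDerivAt).differentiableAt
    refine (pd_sum (f := fun (σ : Equiv.Perm ι) z => Equiv.Perm.sign σ • ∏ i, A z (σ i) i) k
      fun σ _ => (hprod σ).const_smul _).trans ?_
    rw [Finset.sum_comm]
    refine Finset.sum_congr rfl fun σ _ => ?_
    have h2 := HasFDerivAt.finsetProd (u := Finset.univ)
      (fun i _ => (hA (σ i) i).hasFDerivAt)
    rw [← Finset.smul_sum]
    have h3 : pd k (fun z => ∏ i, A z (σ i) i) y =
        ∑ i, ∏ j, (A y).updateCol i (fun a => pdMat k A y a i) (σ j) j := by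
      rw [pd, h2.fderiv]
      simp only [_root_.sum_apply, _root_.smul_apply, smul_eq_mul]
      refine Finset.sum_congr rfl fun i _ => ?_
      rw [← Finset.prod_erase_mul _ _ (Finset.mem_univ i)]
      congr 1
      · refine Finset.prod_congr rfl fun j hj => ?_
        rw [Matrix.updateCol_ne (Finset.ne_of_mem_erase hj)]
      · simp [pdMat, pd]
    rw [← h3]
    simp only [Units.smul_def, zsmul_eq_mul]
    rw [pd_mul k (by fun_prop) (hprod σ), pd_const]
    ring
  rw [h1]
  simp only [← Matrix.cramer_apply, Matrix.cramer_eq_adjugate_mulVec]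
  have h4 : (A y).adjugate = (A y).det • (A y)⁻¹ := by
    rw [Matrix.inv_def, Ring.inverse_eq_inv', smul_smul, mul_inv_cancel₀ hdet, one_smul]
  simp only [h4, Matrix.trace, Matrix.diag, Finset.mul_sum]
  refine Finset.sum_congr rfl fun i _ => ?_
  simp [Matrix.mul_apply, Matrix.mulVec, dotProduct, Finset.mul_sum, mul_assoc]

lemma timeDerivMat_inv {T t : ℝ} (ht : t ∈ Ico 0 T) {A : ℝ → Matrix ι ι ℝ}
    (hA : ∀ i j, DifferentiableWithinAt ℝ (fun s => A s i j) (Ico 0 T) t)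
    (hA' : ∀ i j, DifferentiableWithinAt ℝ (fun s => (A s)⁻¹ i j) (Ico 0 T) t)
    (hdet : ∀ s ∈ Ico 0 T, (A s).det ≠ 0) :
    timeDerivMat T (fun s => (A s)⁻¹) t = -((A t)⁻¹ * timeDerivMat T A t * (A t)⁻¹) := by
  have h1 : timeDerivMat T (fun s => (A s)⁻¹ * A s) t = 0 := by
    ext i j
    simp only [timeDerivMat, Matrix.of_apply, Matrix.zero_apply]
    rw [timeDeriv_congr (h := fun _ => (1 : Matrix ι ι ℝ) i j)
      (fun s hs => by simp only [Matrix.nonsing_inv_mul _ (hdet s hs).isUnit]) ht]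
    simp [timeDeriv]
  rw [timeDerivMat_mul ht hA' hA] at h1
  have h2 := congrArg (· * (A t)⁻¹) (eq_neg_of_add_eq_zero_left h1)
  simpa [Matrix.mul_assoc, Matrix.mul_nonsing_inv _ (hdet t ht).isUnit] using h2

end MatrixCalculus

/-! ### The metric in a chart -/

section ChartMetric

open Matrix

variable {n : ℕ} {M : Type*} [TopologicalSpace M] [ChartedSpace (E n) M]

/-- The differential of the inverse of the chart `φ`, as a map between copies of the model
space. -/
def dsymm (φ : Chart n M) (y : E n) : E n →L[ℝ] E n :=
  mfderiv 𝓘(ℝ, E n) 𝓘(ℝ, E n) φ.symm y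

lemma mdifferentiable_of_mem_smoothCharts {φ : Chart n M} (hφ : φ ∈ smoothCharts n M) :
    φ.MDifferentiable 𝓘(ℝ, E n) 𝓘(ℝ, E n) :=
  ⟨(contMDiffOn_of_mem_maximalAtlas hφ).mdifferentiableOn (by simp),
    (contMDiffOn_symm_of_mem_maximalAtlas hφ).mdifferentiableOn (by simp)⟩

variable [IsManifold 𝓘(ℝ, E n) ∞ M]

/-- The scalar product `g` at the point `x`, on the model space, to which all tangent spaces are
definitionally equal. Forgetting the base point in the type allows rewriting it. -/
def innerAt (g : Metric n M) (x : M) : E n →L[ℝ] E n →L[ℝ] ℝ := g.inner x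

lemma gLow_apply (g : Metric n M) (φ : Chart n M) (y : E n) (i j : Fin n) :
    gLow g φ y i j = innerAt g (φ.symm y) (dsymm φ y (EuclideanSpace.single i 1))
      (dsymm φ y (EuclideanSpace.single j 1)) := rfl

/-- The components of `g` in every smooth chart are smooth functions of the coordinates. For the
metrics of a flow this is part of the definition of the flow. -/
def SmoothComponents (g : Metric n M) : Prop :=
  ∀ φ ∈ smoothCharts n M, ∀ i j, ContDiffOn ℝ ∞ (fun y => gLow g φ y i j) φ.target

variable (g : Metric n M) {φ : Chart n M} {y : E n}

lemma gLow_transpose (φ : Chart n M) (y : E n) : (gLow g φ y)ᵀ = gLow g φ y := by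
  ext i j
  exact g.symm _ _ _

lemma gLow_symm (φ : Chart n M) (y : E n) (i j : Fin n) : gLow g φ y i j = gLow g φ y j i :=
  g.symm _ _ _

lemma gUp_transpose (φ : Chart n M) (y : E n) : (gUp g φ y)ᵀ = gUp g φ y := by
  rw [gUp, transpose_nonsing_inv, gLow_transpose]

lemma gUp_symm (φ : Chart n M) (y : E n) (i j : Fin n) : gUp g φ y i j = gUp g φ y j i :=
  congrFun (congrFun (gUp_transpose g φ y) j) i

lemma gLow_posDef (hφ : φ ∈ smoothCharts n M) (hy : y ∈ φ.target) : (gLow g φ y).PosDef := by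
  refine PosDef.of_dotProduct_mulVec_pos ?_ fun v hv => ?_
  · rw [IsHermitian, conjTranspose_eq_transpose_of_trivial, gLow_transpose]
  · set w : E n := ∑ i, v i • EuclideanSpace.single i (1 : ℝ)
    have hw : w ≠ 0 := by
      intro h0
      apply hv
      ext i
      have : w i = 0 := by rw [h0]; rfl
      simpa [w, Pi.single_apply] using this
    have hinj : Function.Injective (dsymm φ y) :=
      (mdifferentiable_of_mem_smoothCharts hφ).symm.mfderiv_injective hy
    have hpos : 0 < innerAt g (φ.symm y) (dsymm φ y w) (dsymm φ y w) :=
      g.pos _ _ fun h0 => hw (hinj (h0.trans (map_zero _).symm))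
    have heq : innerAt g (φ.symm y) (dsymm φ y w) (dsymm φ y w) = star v ⬝ᵥ gLow g φ y *ᵥ v := by
      simp only [w, map_sum, map_smul, _root_.sum_apply, _root_.smul_apply, dotProduct, mulVec,
        gLow_apply, smul_eq_mul, star_trivial, Finset.mul_sum]
      rw [Finset.sum_comm]
      exact Finset.sum_congr rfl fun i _ => Finset.sum_congr rfl fun j _ => by ring
    rwa [← heq]

lemma gLow_det_pos (hφ : φ ∈ smoothCharts n M) (hy : y ∈ φ.target) : 0 < (gLow g φ y).det :=
  (gLow_posDef g hφ hy).det_pos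

lemma gLow_det_ne_zero (hφ : φ ∈ smoothCharts n M) (hy : y ∈ φ.target) : (gLow g φ y).det ≠ 0 :=
  (gLow_det_pos g hφ hy).ne'

lemma gUp_mul_gLow (hφ : φ ∈ smoothCharts n M) (hy : y ∈ φ.target) :
    gUp g φ y * gLow g φ y = 1 :=
  nonsing_inv_mul _ (gLow_det_ne_zero g hφ hy).isUnit

lemma gLow_mul_gUp (hφ : φ ∈ smoothCharts n M) (hy : y ∈ φ.target) :
    gLow g φ y * gUp g φ y = 1 :=
  mul_nonsing_inv _ (gLow_det_ne_zero g hφ hy).isUnit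

variable {g}

lemma contDiffOn_gUp (hg : SmoothComponents g) (hφ : φ ∈ smoothCharts n M) (i j : Fin n) :
    ContDiffOn ℝ ∞ (fun y => gUp g φ y i j) φ.target :=
  contDiffOn_inv_apply (hg φ hφ) (fun _ hy => gLow_det_ne_zero g hφ hy) i j

lemma contDiffOn_christoffel (hg : SmoothComponents g) (hφ : φ ∈ smoothCharts n M)
    (k i j : Fin n) : ContDiffOn ℝ ∞ (fun y => christoffel g φ y k i j) φ.target := by
  have h (a b c : Fin n) := contDiffOn_pd a φ.open_target (hg φ hφ b c)
  exact contDiffOn_const.mul (ContDiffOn.sum fun l _ => (contDiffOn_gUp hg hφ k l).mul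
    (((h i j l).add (h j i l)).sub (h l i j)))

/-! ### The Levi-Civita connection in a chart

The Christoffel symbols are the only symbols which are symmetric in their lower indices and
compatible with the metric. -/

variable (g) in
/-- The matrix `(Γ_i)^k_j = Γ^k_{ij}` of the connection in the direction of `∂/∂xⁱ`. -/
def connMat (φ : Chart n M) (y : E n) (i : Fin n) : Matrix (Fin n) (Fin n) ℝ :=
  Matrix.of fun k j => christoffel g φ y k i j

lemma christoffel_symm (φ : Chart n M) (y : E n) (k i j : Fin n) :
    christoffel g φ y k i j = christoffel g φ y k j i := by
  simp only [christoffel]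
  congr 1
  refine Finset.sum_congr rfl fun l _ => ?_
  simp only [gLow_symm g φ _ i j]
  ring

lemma gLow_mul_connMat (hφ : φ ∈ smoothCharts n M) (hy : y ∈ φ.target) (l i j : Fin n) :
    (gLow g φ y * connMat g φ y i) l j = (1 / 2) *
      (pd i (fun z => gLow g φ z j l) y + pd j (fun z => gLow g φ z i l) y
        - pd l (fun z => gLow g φ z i j) y) := by
  -- `w` is the column of Christoffel symbols of the first kind, and `Γ_i` is `g⁻¹ w` by definition
  set w : Fin n → ℝ := fun l => (1 / 2) *
      (pd i (fun z => gLow g φ z j l) y + pd j (fun z => gLow g φ z i l) y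
        - pd l (fun z => gLow g φ z i j) y) with hw
  have h1 : (fun k => connMat g φ y i k j) = gUp g φ y *ᵥ w := by
    ext k
    simp only [connMat, of_apply, christoffel, mulVec, dotProduct, hw, Finset.mul_sum]
    exact Finset.sum_congr rfl fun l _ => by ring
  have h2 : (gLow g φ y * connMat g φ y i) l j = (gLow g φ y *ᵥ fun k => connMat g φ y i k j) l := rfl
  rw [h2, h1, mulVec_mulVec, gLow_mul_gUp g hφ hy, one_mulVec]

/-- The connection is compatible with the metric. -/
lemma pdMat_gLow (hφ : φ ∈ smoothCharts n M) (hy : y ∈ φ.target) (i : Fin n) :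
    pdMat i (gLow g φ) y = (connMat g φ y i)ᵀ * gLow g φ y + gLow g φ y * connMat g φ y i := by
  have h1 : (connMat g φ y i)ᵀ * gLow g φ y = (gLow g φ y * connMat g φ y i)ᵀ := by
    rw [transpose_mul, gLow_transpose]
  ext l j
  rw [h1, Matrix.add_apply, transpose_apply, gLow_mul_connMat hφ hy, gLow_mul_connMat hφ hy]
  have h2 : pd i (fun z => gLow g φ z j l) y = pd i (fun z => gLow g φ z l j) y :=
    congrArg (fun f => pd i f y) (funext fun z => gLow_symm g φ z j l)
  change pd i (fun z => gLow g φ z l j) y = _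
  rw [h2]
  ring

/-- Uniqueness of the Levi-Civita connection: matrices `P i` with `(P i)^k_j` symmetric in `i, j`
and `∂_i g = (P i)ᵀ g + g (P i)` are those of the Christoffel symbols. -/
lemma connMat_unique (hφ : φ ∈ smoothCharts n M) (hy : y ∈ φ.target)
    (P : Fin n → Matrix (Fin n) (Fin n) ℝ) (hsymm : ∀ i j k, P i k j = P j k i)
    (hP : ∀ i, pdMat i (gLow g φ) y = (P i)ᵀ * gLow g φ y + gLow g φ y * P i) (i : Fin n) :
    connMat g φ y i = P i := by
  have hp (i j l : Fin n) : pd i (fun z => gLow g φ z j l) y =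
      (gLow g φ y * P i) l j + (gLow g φ y * P i) j l := by
    have h1 : (P i)ᵀ * gLow g φ y = (gLow g φ y * P i)ᵀ := by
      rw [transpose_mul, gLow_transpose]
    have := congrFun (congrFun (hP i) j) l
    rwa [h1] at this
  have hs (i j l : Fin n) : (gLow g φ y * P i) l j = (gLow g φ y * P j) l i := by
    simp only [Matrix.mul_apply, hsymm i j]
  have h2 : gLow g φ y * connMat g φ y i = gLow g φ y * P i := by
    ext l j
    rw [gLow_mul_connMat hφ hy, hp, hp, hp, hs j i l, hs i l j, hs j l i]
    ring
  calc connMat g φ y i = gUp g φ y * (gLow g φ y * connMat g φ y i) := by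
        rw [← Matrix.mul_assoc, gUp_mul_gLow g hφ hy, Matrix.one_mul]
    _ = P i := by rw [h2, ← Matrix.mul_assoc, gUp_mul_gLow g hφ hy, Matrix.one_mul]

lemma pdMat_gUp (hg : SmoothComponents g) (hφ : φ ∈ smoothCharts n M) (hy : y ∈ φ.target)
    (i : Fin n) : pdMat i (gUp g φ) y =
      -(gUp g φ y * (connMat g φ y i)ᵀ + connMat g φ y i * gUp g φ y) := by
  have h1 : pdMat i (gUp g φ) y = -(gUp g φ y * pdMat i (gLow g φ) y * gUp g φ y) :=
    pdMat_inv φ.open_target (hg φ hφ) (fun _ hz => gLow_det_ne_zero g hφ hz) hy i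
  rw [h1, pdMat_gLow hφ hy]
  have h2 : gUp g φ y * ((connMat g φ y i)ᵀ * gLow g φ y + gLow g φ y * connMat g φ y i)
      * gUp g φ y = gUp g φ y * (connMat g φ y i)ᵀ * (gLow g φ y * gUp g φ y)
        + (gUp g φ y * gLow g φ y) * connMat g φ y i * gUp g φ y := by
    simp only [Matrix.mul_add, Matrix.add_mul, Matrix.mul_assoc]
  rw [h2, gLow_mul_gUp g hφ hy, gUp_mul_gLow g hφ hy, Matrix.mul_one, Matrix.one_mul]

/-- The inverse metric is divergence free. -/
lemma divTensor_gUp (hg : SmoothComponents g) (hφ : φ ∈ smoothCharts n M) (hy : y ∈ φ.target)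
    (j : Fin n) : divTensor g φ (fun z a b => gUp g φ z a b) y j = 0 := by
  have h1 (i : Fin n) : pd i (fun z => gUp g φ z i j) y =
      -((∑ k, gUp g φ y i k * christoffel g φ y j i k)
        + ∑ k, christoffel g φ y i i k * gUp g φ y k j) :=
    congrFun (congrFun (pdMat_gUp hg hφ hy i) i) j
  simp only [divTensor, h1, ← Finset.sum_add_distrib]
  refine Finset.sum_eq_zero fun i _ => ?_
  rw [← sub_eq_neg_add, sub_eq_zero]
  exact Finset.sum_congr rfl fun k _ => by ring

/-- The Riemannian density `√(det g)` satisfies `∂_k √(det g) = √(det g) Γ^i_{ik}`. -/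
lemma pd_sqrt_det (hg : SmoothComponents g) (hφ : φ ∈ smoothCharts n M) (hy : y ∈ φ.target)
    (k : Fin n) : pd k (fun z => Real.sqrt (gLow g φ z).det) y =
      Real.sqrt (gLow g φ y).det * ∑ i, christoffel g φ y i i k := by
  have hpos := gLow_det_pos g hφ hy
  have hd : DifferentiableAt ℝ (fun z => (gLow g φ z).det) y :=
    differentiableAt_of_contDiffOn φ.open_target (contDiffOn_det (hg φ hφ)) hy
  have htr : ((gLow g φ y)⁻¹ * pdMat k (gLow g φ) y).trace = 2 * (connMat g φ y k).trace := by
    change (gUp g φ y * pdMat k (gLow g φ) y).trace = _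
    rw [pdMat_gLow hφ hy, Matrix.mul_add, trace_add, ← Matrix.mul_assoc, trace_mul_comm,
      ← Matrix.mul_assoc, ← Matrix.mul_assoc, gUp_mul_gLow g hφ hy, gLow_mul_gUp g hφ hy,
      Matrix.one_mul, Matrix.one_mul, trace_transpose]
    ring
  have htr' : (connMat g φ y k).trace = ∑ i, christoffel g φ y i i k :=
    Finset.sum_congr rfl fun i _ => christoffel_symm φ y i k i
  have h1 : pd k (fun z => Real.sqrt (gLow g φ z).det) y =
      1 / (2 * Real.sqrt (gLow g φ y).det) * pd k (fun z => (gLow g φ z).det) y := by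
    simp only [pd, (hd.hasFDerivAt.sqrt hpos.ne').fderiv, _root_.smul_apply, smul_eq_mul]
  rw [h1, pd_det (fun i j => differentiableAt_of_contDiffOn φ.open_target (hg φ hφ i j) hy)
    hpos.ne', htr, htr']
  have hs : 0 < Real.sqrt (gLow g φ y).det := Real.sqrt_pos.2 hpos
  field_simp
  rw [Real.sq_sqrt hpos.le]

/-- The components `∂_i ∂_j f - Γ^k_{ij} ∂_k f` of the Hessian. -/
def hessMat (g : Metric n M) (φ : Chart n M) (f : M → ℝ) (y : E n) : Matrix (Fin n) (Fin n) ℝ :=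
  Matrix.of fun i j => pd i (cpd φ j f) y - ∑ k, christoffel g φ y k i j * cpd φ k f y

/-- The product rule `∇_i (A^{ij} ∇_j f) = (∇_i A^{ij}) ∇_j f + A^{ij} ∇_i ∇_j f`. -/
lemma divVec_mulVec {A : E n → Fin n → Fin n → ℝ} {f : M → ℝ}
    (hA : ∀ i j, DifferentiableAt ℝ (fun z => A z i j) y)
    (hf : ∀ j, DifferentiableAt ℝ (cpd φ j f) y) :
    divVec g φ (fun z i => ∑ j, A z i j * cpd φ j f z) y =
      ∑ j, divTensor g φ A y j * cpd φ j f y + ∑ i, ∑ j, A y i j * hessMat g φ f y i j := by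
  have h1 (i : Fin n) : pd i (fun z => ∑ j, A z i j * cpd φ j f z) y =
      ∑ j, (pd i (fun z => A z i j) y * cpd φ j f y + A y i j * pd i (cpd φ j f) y) := by
    refine (pd_sum (f := fun j z => A z i j * cpd φ j f z) i
      fun j _ => (hA i j).mul (hf j)).trans ?_
    exact Finset.sum_congr rfl fun j _ => pd_mul i (hA i j) (hf j)
  have h3 : ∑ j, (∑ i, ∑ k, christoffel g φ y j i k * A y i k) * cpd φ j f y =
      ∑ i, ∑ j, A y i j * ∑ k, christoffel g φ y k i j * cpd φ k f y := by
    simp only [Finset.sum_mul, Finset.mul_sum]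
    rw [Finset.sum_comm]
    refine Finset.sum_congr rfl fun i _ => ?_
    rw [Finset.sum_comm]
    exact Finset.sum_congr rfl fun k _ => Finset.sum_congr rfl fun j _ => by ring
  have h4 : ∑ j, (∑ i, ∑ k, christoffel g φ y i i k * A y k j) * cpd φ j f y =
      ∑ i, ∑ k, christoffel g φ y i i k * ∑ j, A y k j * cpd φ j f y := by
    simp only [Finset.sum_mul, Finset.mul_sum]
    rw [Finset.sum_comm]
    refine Finset.sum_congr rfl fun i _ => ?_
    rw [Finset.sum_comm]
    exact Finset.sum_congr rfl fun k _ => Finset.sum_congr rfl fun j _ => by ring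
  have h5 : ∑ j, (∑ i, pd i (fun z => A z i j) y) * cpd φ j f y =
      ∑ i, ∑ j, pd i (fun z => A z i j) y * cpd φ j f y := by
    simp only [Finset.sum_mul]
    exact Finset.sum_comm
  simp only [divVec, h1, divTensor, hessMat, of_apply, Finset.sum_add_distrib, add_mul, mul_sub,
    Finset.sum_sub_distrib, h3, h4, h5]
  ring

/-- `Δf = g^{ij} (∂_i ∂_j f - Γ^k_{ij} ∂_k f)`. -/
lemma divVec_grad (hg : SmoothComponents g) (hφ : φ ∈ smoothCharts n M) (hy : y ∈ φ.target)
    {f : M → ℝ} (hf : ∀ j, DifferentiableAt ℝ (cpd φ j f) y) :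
    divVec g φ (grad g φ f) y = ∑ i, ∑ j, gUp g φ y i j * hessMat g φ f y i j := by
  have := divVec_mulVec (g := g) (φ := φ) (A := fun z a b => gUp g φ z a b)
    (fun i j => differentiableAt_of_contDiffOn φ.open_target (contDiffOn_gUp hg hφ i j) hy) hf
  simp only [divTensor_gUp hg hφ hy, zero_mul, Finset.sum_const_zero, zero_add] at this
  exact this

/-- The product rule `div (f X) = f div X + X · ∇f`. -/
lemma divVec_smul {X : E n → Fin n → ℝ} {f : E n → ℝ}
    (hX : ∀ i, DifferentiableAt ℝ (fun z => X z i) y) (hf : DifferentiableAt ℝ f y) :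
    divVec g φ (fun z i => f z * X z i) y = f y * divVec g φ X y + ∑ i, X y i * pd i f y := by
  have h1 (i : Fin n) : pd i (fun z => f z * X z i) y =
      X y i * pd i f y + f y * pd i (fun z => X z i) y := by
    rw [pd_mul i hf (hX i)]; ring
  simp only [divVec, h1, Finset.sum_add_distrib, mul_add, Finset.mul_sum]
  have h2 (i k : Fin n) : christoffel g φ y i i k * (f y * X y k) =
      f y * (christoffel g φ y i i k * X y k) := by ring
  simp only [h2]
  ring

end ChartMetric

/-! ### Changes of coordinates -/

section Transition

open Matrix

variable {n : ℕ} {M : Type*} [TopologicalSpace M] {φ ψ : Chart n M} {y : E n}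

lemma transition_mem_target (hy : y ∈ (ψ.symm.trans φ).source) : φ (ψ.symm y) ∈ φ.target :=
  φ.map_source (by simpa using hy.2)

lemma transition_mem_source (hy : y ∈ (ψ.symm.trans φ).source) : y ∈ ψ.target := by
  simpa using hy.1

lemma symm_transition (hy : y ∈ (ψ.symm.trans φ).source) :
    φ.symm (φ (ψ.symm y)) = ψ.symm y :=
  φ.left_inv (by simpa using hy.2)

lemma mem_transition_source {x : M} (hφ : x ∈ φ.source) (hψ : x ∈ ψ.source) :
    ψ x ∈ (ψ.symm.trans φ).source := by
  simp [ψ.map_source hψ, ψ.left_inv hψ, hφ]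

variable [ChartedSpace (E n) M]

/-- The Jacobian matrix of the change of coordinates `φ ∘ ψ⁻¹`, at the point with coordinates `y`
in `ψ`. The rows are indexed by the coordinates of `φ`, the columns by those of `ψ`. -/
def jac (φ ψ : Chart n M) (y : E n) : Matrix (Fin n) (Fin n) ℝ :=
  Matrix.of fun a i => pd i (fun z => φ (ψ.symm z) a) y

/-- Smoothness of a function on `M`, expressed in charts. -/
def SmoothOnCharts (f : M → ℝ) : Prop :=
  ∀ φ ∈ smoothCharts n M, ContDiffOn ℝ ∞ (fun y => f (φ.symm y)) φ.target

lemma contDiffOn_transition (hφ : φ ∈ smoothCharts n M) (hψ : ψ ∈ smoothCharts n M) :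
    ContDiffOn ℝ ∞ (fun z => φ (ψ.symm z)) (ψ.symm.trans φ).source := by
  rw [← contMDiffOn_iff_contDiffOn]
  exact (contMDiffOn_of_mem_maximalAtlas hφ).comp
    ((contMDiffOn_symm_of_mem_maximalAtlas hψ).mono fun _ hz => transition_mem_source hz)
    fun z hz => by simpa using hz.2

lemma differentiableAt_transition (hφ : φ ∈ smoothCharts n M) (hψ : ψ ∈ smoothCharts n M)
    (hy : y ∈ (ψ.symm.trans φ).source) : DifferentiableAt ℝ (fun z => φ (ψ.symm z)) y :=
  ((contDiffOn_transition hφ hψ).contDiffAt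
    ((ψ.symm.trans φ).open_source.mem_nhds hy)).differentiableAt (by simp)

lemma contDiffOn_transition_apply (hφ : φ ∈ smoothCharts n M) (hψ : ψ ∈ smoothCharts n M)
    (a : Fin n) : ContDiffOn ℝ ∞ (fun z => φ (ψ.symm z) a) (ψ.symm.trans φ).source :=
  (EuclideanSpace.proj (𝕜 := ℝ) a).contDiff.comp_contDiffOn (contDiffOn_transition hφ hψ)

lemma contDiffOn_jac (hφ : φ ∈ smoothCharts n M) (hψ : ψ ∈ smoothCharts n M) (a i : Fin n) :
    ContDiffOn ℝ ∞ (fun z => jac φ ψ z a i) (ψ.symm.trans φ).source :=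
  contDiffOn_pd i (ψ.symm.trans φ).open_source (contDiffOn_transition_apply hφ hψ a)

lemma pdMat_jac_symm (hφ : φ ∈ smoothCharts n M) (hψ : ψ ∈ smoothCharts n M)
    (hy : y ∈ (ψ.symm.trans φ).source) (i j a : Fin n) :
    pdMat i (jac φ ψ) y a j = pdMat j (jac φ ψ) y a i :=
  pd_pd_comm (ψ.symm.trans φ).open_source (contDiffOn_transition_apply hφ hψ a) hy i j

lemma fderiv_transition_single (hφ : φ ∈ smoothCharts n M) (hψ : ψ ∈ smoothCharts n M)
    (hy : y ∈ (ψ.symm.trans φ).source) (i : Fin n) :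
    fderiv ℝ (fun z => φ (ψ.symm z)) y (EuclideanSpace.single i 1) =
      ∑ a, jac φ ψ y a i • EuclideanSpace.single a (1 : ℝ) := by
  have h (a : Fin n) : jac φ ψ y a i =
      fderiv ℝ (fun z => φ (ψ.symm z)) y (EuclideanSpace.single i 1) a :=
    congrArg (fun L => L (EuclideanSpace.single i (1 : ℝ)))
      ((EuclideanSpace.proj (𝕜 := ℝ) a).hasFDerivAt.comp y
        (differentiableAt_transition hφ hψ hy).hasFDerivAt).fderiv
  simp only [h]
  conv_lhs => rw [← (EuclideanSpace.basisFun (Fin n) ℝ).sum_repr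
    (fderiv ℝ (fun z => φ (ψ.symm z)) y (EuclideanSpace.single i 1))]
  simp

lemma pd_comp_transition (hφ : φ ∈ smoothCharts n M) (hψ : ψ ∈ smoothCharts n M)
    (hy : y ∈ (ψ.symm.trans φ).source) {f : E n → ℝ}
    (hf : DifferentiableAt ℝ f (φ (ψ.symm y))) (i : Fin n) :
    pd i (fun z => f (φ (ψ.symm z))) y = ∑ c, jac φ ψ y c i * pd c f (φ (ψ.symm y)) :=
  pd_comp i hf (differentiableAt_transition hφ hψ hy)

lemma pdMat_comp_transition {ι κ : Type*} (hφ : φ ∈ smoothCharts n M) (hψ : ψ ∈ smoothCharts n M)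
    (hy : y ∈ (ψ.symm.trans φ).source) {A : E n → Matrix ι κ ℝ}
    (hA : ∀ i j, DifferentiableAt ℝ (fun z => A z i j) (φ (ψ.symm y))) (i : Fin n) :
    pdMat i (fun z => A (φ (ψ.symm z))) y = ∑ c, jac φ ψ y c i • pdMat c A (φ (ψ.symm y)) := by
  ext a b
  rw [Matrix.sum_apply]
  exact pd_comp_transition (f := fun z => A z a b) hφ hψ hy (hA a b) i

lemma differentiableAt_comp_transition (hφ : φ ∈ smoothCharts n M) (hψ : ψ ∈ smoothCharts n M)
    (hy : y ∈ (ψ.symm.trans φ).source) {f : E n → ℝ}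
    (hf : DifferentiableAt ℝ f (φ (ψ.symm y))) :
    DifferentiableAt ℝ (fun z => f (φ (ψ.symm z))) y :=
  hf.comp y (differentiableAt_transition hφ hψ hy)

/-- Differentials transform by the Jacobian matrix. -/
lemma cpd_transition (hφ : φ ∈ smoothCharts n M) (hψ : ψ ∈ smoothCharts n M)
    (hy : y ∈ (ψ.symm.trans φ).source) {f : M → ℝ} (hf : SmoothOnCharts (n := n) f) (i : Fin n) :
    cpd ψ i f y = ∑ a, jac φ ψ y a i * cpd φ a f (φ (ψ.symm y)) := by
  rw [cpd, pd_congr_of_eqOn i (ψ.symm.trans φ).open_source hy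
    (h := fun z => f (φ.symm (φ (ψ.symm z)))) fun z hz => by simp only [symm_transition hz]]
  exact pd_comp_transition (f := fun z => f (φ.symm z)) hφ hψ hy
    (differentiableAt_of_contDiffOn φ.open_target (hf φ hφ) (transition_mem_target hy)) i

lemma contDiffOn_cpd {f : M → ℝ} (hf : SmoothOnCharts (n := n) f) (hφ : φ ∈ smoothCharts n M)
    (i : Fin n) : ContDiffOn ℝ ∞ (cpd φ i f) φ.target :=
  contDiffOn_pd i φ.open_target (hf φ hφ)

lemma dsymm_transition (hφ : φ ∈ smoothCharts n M) (hψ : ψ ∈ smoothCharts n M)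
    (hy : y ∈ (ψ.symm.trans φ).source) :
    dsymm ψ y = (dsymm φ (φ (ψ.symm y))).comp (fderiv ℝ (fun z => φ (ψ.symm z)) y) := by
  have h1 : ψ.symm =ᶠ[nhds y] φ.symm ∘ fun z => φ (ψ.symm z) :=
    Filter.eventuallyEq_of_mem ((ψ.symm.trans φ).open_source.mem_nhds hy)
      fun z hz => (symm_transition hz).symm
  have h2 : MDifferentiableAt 𝓘(ℝ, E n) 𝓘(ℝ, E n) φ.symm (φ (ψ.symm y)) :=
    (mdifferentiable_of_mem_smoothCharts hφ).mdifferentiableAt_symm (transition_mem_target hy)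
  have h3 : MDifferentiableAt 𝓘(ℝ, E n) 𝓘(ℝ, E n) (fun z => φ (ψ.symm z)) y :=
    (differentiableAt_transition hφ hψ hy).mdifferentiableAt
  have h4 := mfderiv_comp y h2 h3
  rw [mfderiv_eq_fderiv (f := fun z => φ (ψ.symm z))] at h4
  exact h1.mfderiv_eq.trans h4

variable [IsManifold 𝓘(ℝ, E n) ∞ M]

/-- The components of the metric transform as those of a covariant two-tensor. -/
lemma gLow_transition (g : Metric n M) (hφ : φ ∈ smoothCharts n M) (hψ : ψ ∈ smoothCharts n M)
    (hy : y ∈ (ψ.symm.trans φ).source) :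
    gLow g ψ y = (jac φ ψ y)ᵀ * gLow g φ (φ (ψ.symm y)) * jac φ ψ y := by
  ext i j
  rw [gLow_apply, dsymm_transition hφ hψ hy]
  simp only [ContinuousLinearMap.comp_apply, fderiv_transition_single hφ hψ hy, map_sum, map_smul,
    _root_.sum_apply, _root_.smul_apply, smul_eq_mul, Matrix.mul_apply, transpose_apply,
    gLow_apply, symm_transition hy, Finset.mul_sum, Finset.sum_mul]
  refine Finset.sum_congr rfl fun b _ => Finset.sum_congr rfl fun a _ => by ring

lemma jac_det_ne_zero (g : Metric n M) (hφ : φ ∈ smoothCharts n M) (hψ : ψ ∈ smoothCharts n M)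
    (hy : y ∈ (ψ.symm.trans φ).source) : (jac φ ψ y).det ≠ 0 := by
  intro h
  apply gLow_det_ne_zero g hψ (transition_mem_source hy)
  rw [gLow_transition g hφ hψ hy, det_mul, h, mul_zero]

/-- The transformation law of the Christoffel symbols, `J Γ'_i = (∑_c J^c_i Γ_c) J + ∂_i J` for the
Jacobian matrix `J`: the matrices defined by it are torsion free and compatible with `Jᵀ g J`, so
that the uniqueness of the Levi-Civita connection applies. -/
lemma jac_mul_connMat {g : Metric n M} (hg : SmoothComponents g) (hφ : φ ∈ smoothCharts n M)
    (hψ : ψ ∈ smoothCharts n M) (hy : y ∈ (ψ.symm.trans φ).source) (i : Fin n) :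
    jac φ ψ y * connMat g ψ y i =
      (∑ c, jac φ ψ y c i • connMat g φ (φ (ψ.symm y)) c) * jac φ ψ y
        + pdMat i (jac φ ψ) y := by
  have hy' := transition_mem_target hy
  set J := jac φ ψ y with hJ
  set G := gLow g φ (φ (ψ.symm y)) with hG
  have hGt : Gᵀ = G := gLow_transpose g φ _
  set A : Fin n → Matrix (Fin n) (Fin n) ℝ :=
    fun i => ∑ c, J c i • connMat g φ (φ (ψ.symm y)) c with hA
  set Q : Fin n → Matrix (Fin n) (Fin n) ℝ := fun i => A i * J + pdMat i (jac φ ψ) y with hQ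
  have hdet : IsUnit J.det := (jac_det_ne_zero g hφ hψ hy).isUnit
  have hg' : gLow g ψ y = Jᵀ * G * J := gLow_transition g hφ hψ hy
  -- vanishing torsion; the derivatives of `J` are symmetric second derivatives
  have hQs (i j a : Fin n) : Q i a j = Q j a i := by
    have h1 : (A i * J) a j = (A j * J) a i := by
      simp only [hA, Finset.sum_mul, Matrix.sum_apply, Matrix.smul_apply,
        Matrix.mul_apply, connMat, of_apply, smul_eq_mul]
      rw [Finset.sum_comm]
      refine Finset.sum_congr rfl fun b _ => Finset.sum_congr rfl fun c _ => ?_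
      rw [christoffel_symm φ _ a b c]
      ring
    simp only [hQ, Matrix.add_apply, h1, pdMat_jac_symm hφ hψ hy i j a]
  have hJd (a b : Fin n) : DifferentiableAt ℝ (fun z => jac φ ψ z a b) y :=
    differentiableAt_of_contDiffOn (ψ.symm.trans φ).open_source (contDiffOn_jac hφ hψ a b) hy
  have hGd (a b : Fin n) : DifferentiableAt ℝ (fun z => gLow g φ z a b) (φ (ψ.symm y)) :=
    differentiableAt_of_contDiffOn φ.open_target (hg φ hφ a b) hy'
  have hGd' (a b : Fin n) : DifferentiableAt ℝ (fun z => gLow g φ (φ (ψ.symm z)) a b) y :=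
    differentiableAt_comp_transition (f := fun z => gLow g φ z a b) hφ hψ hy (hGd a b)
  have hdG (i : Fin n) : pdMat i (fun z => gLow g φ (φ (ψ.symm z))) y = (A i)ᵀ * G + G * A i := by
    rw [pdMat_comp_transition hφ hψ hy hGd]
    simp only [pdMat_gLow hφ hy', hA, transpose_sum, transpose_smul, Finset.sum_mul,
      Finset.mul_sum, smul_add, Finset.sum_add_distrib, Matrix.smul_mul, Matrix.mul_smul, hG]
    rfl
  -- compatibility with the metric
  have hdg (i : Fin n) : pdMat i (gLow g ψ) y = (Q i)ᵀ * G * J + Jᵀ * G * Q i := by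
    rw [pdMat_congr (ψ.symm.trans φ).open_source hy
      (B := fun z => (jac φ ψ z)ᵀ * gLow g φ (φ (ψ.symm z)) * jac φ ψ z)
      (fun z hz => gLow_transition g hφ hψ hz),
      pdMat_mul (A := fun z => (jac φ ψ z)ᵀ * gLow g φ (φ (ψ.symm z)))
        (differentiableAt_mul_apply (A := fun z => (jac φ ψ z)ᵀ) (fun a b => hJd b a) hGd') hJd,
      pdMat_mul (A := fun z => (jac φ ψ z)ᵀ) (fun a b => hJd b a) hGd', pdMat_transpose, hdG]
    simp only [hQ, transpose_add, transpose_mul, Matrix.mul_add, Matrix.add_mul, Matrix.mul_assoc,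
      ← hG, ← hJ]
    abel
  have key := connMat_unique hψ (transition_mem_source hy) (fun i => J⁻¹ * Q i)
    (fun i j k => by simp only [Matrix.mul_apply, hQs i j])
    (fun i => by
      have h1 : gLow g ψ y * (J⁻¹ * Q i) = Jᵀ * G * Q i := by
        rw [hg', Matrix.mul_assoc, ← Matrix.mul_assoc J, mul_nonsing_inv _ hdet, Matrix.one_mul]
      have h2 : (J⁻¹ * Q i)ᵀ * gLow g ψ y = (Q i)ᵀ * G * J := by
        rw [← transpose_transpose ((J⁻¹ * Q i)ᵀ * gLow g ψ y), transpose_mul, transpose_transpose,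
          gLow_transpose, h1]
        simp only [transpose_mul, transpose_transpose, hGt, Matrix.mul_assoc]
      rw [hdg, h1, h2]) i
  rw [key, ← Matrix.mul_assoc, mul_nonsing_inv _ hdet, Matrix.one_mul]

end Transition

/-! ### Tensor fields given by their components in all charts

A tensor field on `M` is encoded by its components in every smooth chart, subject to the
transformation law under changes of coordinates. -/

section Tensors

open Matrix

variable {n : ℕ} {M : Type*} [TopologicalSpace M] [ChartedSpace (E n) M]

/-- A smooth function on `M`, given by its expressions in charts. -/
structure IsScalar (L : Chart n M → E n → ℝ) : Prop where
  smooth : ∀ φ ∈ smoothCharts n M, ContDiffOn ℝ ∞ (L φ) φ.target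
  transform : ∀ φ ∈ smoothCharts n M, ∀ ψ ∈ smoothCharts n M, ∀ y ∈ (ψ.symm.trans φ).source,
    L ψ y = L φ (φ (ψ.symm y))

/-- A smooth vector field on `M`, given by its components in charts. -/
structure IsVector (X : Chart n M → E n → Fin n → ℝ) : Prop where
  smooth : ∀ φ ∈ smoothCharts n M, ∀ i, ContDiffOn ℝ ∞ (fun y => X φ y i) φ.target
  transform : ∀ φ ∈ smoothCharts n M, ∀ ψ ∈ smoothCharts n M, ∀ y ∈ (ψ.symm.trans φ).source,
    X φ (φ (ψ.symm y)) = jac φ ψ y *ᵥ X ψ y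

/-- A smooth one-form on `M`, given by its components in charts. -/
structure IsCovector (η : Chart n M → E n → Fin n → ℝ) : Prop where
  smooth : ∀ φ ∈ smoothCharts n M, ∀ i, ContDiffOn ℝ ∞ (fun y => η φ y i) φ.target
  transform : ∀ φ ∈ smoothCharts n M, ∀ ψ ∈ smoothCharts n M, ∀ y ∈ (ψ.symm.trans φ).source,
    η ψ y = η φ (φ (ψ.symm y)) ᵥ* jac φ ψ y

/-- A smooth covariant two-tensor on `M`, given by its components in charts. -/
structure IsCovTensor (A : Chart n M → E n → Matrix (Fin n) (Fin n) ℝ) : Prop where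
  smooth : ∀ φ ∈ smoothCharts n M, ∀ i j, ContDiffOn ℝ ∞ (fun y => A φ y i j) φ.target
  transform : ∀ φ ∈ smoothCharts n M, ∀ ψ ∈ smoothCharts n M, ∀ y ∈ (ψ.symm.trans φ).source,
    A ψ y = (jac φ ψ y)ᵀ * A φ (φ (ψ.symm y)) * jac φ ψ y

/-- A smooth contravariant two-tensor on `M`, given by its components in charts. -/
structure IsContraTensor (A : Chart n M → E n → Matrix (Fin n) (Fin n) ℝ) : Prop where
  smooth : ∀ φ ∈ smoothCharts n M, ∀ i j, ContDiffOn ℝ ∞ (fun y => A φ y i j) φ.target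
  transform : ∀ φ ∈ smoothCharts n M, ∀ ψ ∈ smoothCharts n M, ∀ y ∈ (ψ.symm.trans φ).source,
    A φ (φ (ψ.symm y)) = jac φ ψ y * A ψ y * (jac φ ψ y)ᵀ

lemma SmoothOnCharts.isScalar {f : M → ℝ} (hf : SmoothOnCharts (n := n) f) :
    IsScalar fun (φ : Chart n M) y => f (φ.symm y) :=
  ⟨hf, fun φ _ ψ _ y hy => by rw [symm_transition hy]⟩

lemma SmoothOnCharts.isCovector {f : M → ℝ} (hf : SmoothOnCharts (n := n) f) :
    IsCovector fun (φ : Chart n M) y i => cpd φ i f y where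
  smooth φ hφ i := contDiffOn_cpd hf hφ i
  transform φ hφ ψ hψ y hy := by
    ext i
    rw [cpd_transition hφ hψ hy hf]
    exact Finset.sum_congr rfl fun a _ => mul_comm _ _

lemma IsScalar.sub {L L' : Chart n M → E n → ℝ} (h : IsScalar L) (h' : IsScalar L') :
    IsScalar fun φ y => L φ y - L' φ y where
  smooth φ hφ := (h.smooth φ hφ).sub (h'.smooth φ hφ)
  transform φ hφ ψ hψ y hy := by rw [h.transform φ hφ ψ hψ y hy, h'.transform φ hφ ψ hψ y hy]

lemma IsScalar.smul_vector {L : Chart n M → E n → ℝ} {X : Chart n M → E n → Fin n → ℝ}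
    (h : IsScalar L) (hX : IsVector X) : IsVector fun φ y i => L φ y * X φ y i where
  smooth φ hφ i := (h.smooth φ hφ).mul (hX.smooth φ hφ i)
  transform φ hφ ψ hψ y hy := by
    have : (fun i => L ψ y * X ψ y i) = L ψ y • X ψ y := rfl
    rw [this, mulVec_smul, ← hX.transform φ hφ ψ hψ y hy, h.transform φ hφ ψ hψ y hy]
    rfl

lemma IsVector.contract {X η : Chart n M → E n → Fin n → ℝ} (hX : IsVector X)
    (hη : IsCovector η) : IsScalar fun φ y => ∑ i, η φ y i * X φ y i where
  smooth φ hφ := ContDiffOn.sum fun i _ => (hη.smooth φ hφ i).mul (hX.smooth φ hφ i)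
  transform φ hφ ψ hψ y hy := by
    change η ψ y ⬝ᵥ X ψ y = η φ (φ (ψ.symm y)) ⬝ᵥ X φ (φ (ψ.symm y))
    rw [hX.transform φ hφ ψ hψ y hy, hη.transform φ hφ ψ hψ y hy, ← dotProduct_mulVec]

lemma IsContraTensor.mulVec {A : Chart n M → E n → Matrix (Fin n) (Fin n) ℝ}
    {η : Chart n M → E n → Fin n → ℝ} (hA : IsContraTensor A) (hη : IsCovector η) :
    IsVector fun φ y i => ∑ j, A φ y i j * η φ y j where
  smooth φ hφ i := ContDiffOn.sum fun j _ => (hA.smooth φ hφ i j).mul (hη.smooth φ hφ j)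
  transform φ hφ ψ hψ y hy := by
    change A φ (φ (ψ.symm y)) *ᵥ η φ (φ (ψ.symm y)) = jac φ ψ y *ᵥ (A ψ y *ᵥ η ψ y)
    rw [hA.transform φ hφ ψ hψ y hy, hη.transform φ hφ ψ hψ y hy, mulVec_mulVec,
      ← mulVec_transpose, mulVec_mulVec]

lemma IsContraTensor.contract {A B : Chart n M → E n → Matrix (Fin n) (Fin n) ℝ}
    (hA : IsContraTensor A) (hB : IsCovTensor B) :
    IsScalar fun φ y => ∑ i, ∑ j, A φ y i j * B φ y i j where
  smooth φ hφ := ContDiffOn.sum fun i _ => ContDiffOn.sum fun j _ =>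
    (hA.smooth φ hφ i j).mul (hB.smooth φ hφ i j)
  transform φ hφ ψ hψ y hy := by
    have h (P Q : Matrix (Fin n) (Fin n) ℝ) : ∑ i, ∑ j, P i j * Q i j = (P * Qᵀ).trace := by
      simp [Matrix.trace, Matrix.mul_apply]
    simp only [h]
    rw [hA.transform φ hφ ψ hψ y hy, hB.transform φ hφ ψ hψ y hy, transpose_mul, transpose_mul,
      transpose_transpose]
    simp only [Matrix.mul_assoc]
    rw [trace_mul_comm (jac φ ψ y)]
    simp only [Matrix.mul_assoc]

/-- The value at `x` of a scalar given by its expressions in charts does not depend on the chart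
around `x`. -/
lemma IsScalar.apply_eq {L : Chart n M → E n → ℝ} (hL : IsScalar L) {φ ψ : Chart n M}
    (hφ : φ ∈ smoothCharts n M) (hψ : ψ ∈ smoothCharts n M) {x : M} (hx : x ∈ φ.source)
    (hx' : x ∈ ψ.source) : L φ (φ x) = L ψ (ψ x) := by
  rw [hL.transform φ hφ ψ hψ (ψ x) (mem_transition_source hx hx'), ψ.left_inv hx']

variable [IsManifold 𝓘(ℝ, E n) ∞ M] {g : Metric n M}

lemma isContraTensor_gUp (hg : SmoothComponents g) :
    IsContraTensor fun (φ : Chart n M) y => gUp g φ y where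
  smooth φ hφ := contDiffOn_gUp hg hφ
  transform φ hφ ψ hψ y hy := by
    have hdet := (jac_det_ne_zero g hφ hψ hy).isUnit
    have hdet' : IsUnit (jac φ ψ y)ᵀ.det := by rwa [det_transpose]
    rw [gUp, gUp, gLow_transition g hφ hψ hy, Matrix.mul_inv_rev, Matrix.mul_inv_rev,
      Matrix.mul_assoc, Matrix.mul_assoc, Matrix.mul_assoc, nonsing_inv_mul _ hdet',
      Matrix.mul_one, ← Matrix.mul_assoc, mul_nonsing_inv _ hdet, Matrix.one_mul]

/-- The Hessian is a tensor: the second derivatives of the change of coordinates, which appear in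
`∂_i ∂_j f`, are cancelled by those in the transformation law of the Christoffel symbols. -/
lemma isCovTensor_hessMat (hg : SmoothComponents g) {f : M → ℝ}
    (hf : SmoothOnCharts (n := n) f) : IsCovTensor fun (φ : Chart n M) y => hessMat g φ f y where
  smooth φ hφ i j := (contDiffOn_pd i φ.open_target (contDiffOn_cpd hf hφ j)).sub
    (ContDiffOn.sum fun k _ => (contDiffOn_christoffel hg hφ k i j).mul (contDiffOn_cpd hf hφ k))
  transform φ hφ ψ hψ y hy := by
    have hy' := transition_mem_target hy
    -- the differential of `f` as a row vector
    set D : Chart n M → E n → Matrix Unit (Fin n) ℝ := fun φ y => Matrix.of fun _ j => cpd φ j f y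
      with hD
    have hrow (φ : Chart n M) (y : E n) (i j : Fin n) : hessMat g φ f y i j =
        (pdMat i (D φ) y - D φ y * connMat g φ y i) () j := by
      simp only [hessMat, of_apply, Matrix.sub_apply, pdMat, hD, Matrix.mul_apply, connMat]
      congr 1
      exact Finset.sum_congr rfl fun k _ => mul_comm _ _
    have hDt : ∀ z ∈ (ψ.symm.trans φ).source, D ψ z = D φ (φ (ψ.symm z)) * jac φ ψ z := by
      intro z hz
      ext u j
      exact congrFun (hf.isCovector.transform φ hφ ψ hψ z hz) j
    have hDd (u : Unit) (j : Fin n) : DifferentiableAt ℝ (fun z => D φ z u j) (φ (ψ.symm y)) :=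
      differentiableAt_of_contDiffOn φ.open_target (contDiffOn_cpd hf hφ j) hy'
    have h1 (i : Fin n) : pdMat i (D ψ) y - D ψ y * connMat g ψ y i =
        (∑ c, jac φ ψ y c i • (pdMat c (D φ) (φ (ψ.symm y))
          - D φ (φ (ψ.symm y)) * connMat g φ (φ (ψ.symm y)) c)) * jac φ ψ y := by
      rw [pdMat_congr (ψ.symm.trans φ).open_source hy
        (B := fun z => D φ (φ (ψ.symm z)) * jac φ ψ z) hDt,
        pdMat_mul (A := fun z => D φ (φ (ψ.symm z)))
          (fun u j => differentiableAt_comp_transition (f := fun z => D φ z u j) hφ hψ hy (hDd u j))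
          (fun a b => differentiableAt_of_contDiffOn (ψ.symm.trans φ).open_source
            (contDiffOn_jac hφ hψ a b) hy), hDt y hy, Matrix.mul_assoc (D φ _),
        jac_mul_connMat hg hφ hψ hy, pdMat_comp_transition hφ hψ hy hDd]
      simp only [Matrix.mul_add, smul_sub, Finset.sum_sub_distrib, Matrix.sub_mul,
        ← Matrix.mul_assoc, Matrix.mul_sum, Matrix.mul_smul]
      abel
    ext i j
    rw [hrow, h1, Matrix.mul_apply, Matrix.mul_apply]
    refine Finset.sum_congr rfl fun a _ => ?_
    congr 1
    rw [Matrix.sum_apply, Matrix.mul_apply]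
    exact Finset.sum_congr rfl fun c _ => by rw [hrow]; rfl

/-- The divergence of a vector field does not depend on the coordinates, since it is the trace of the
matrix of `∇X`, which is conjugated by the Jacobian matrix. -/
lemma IsVector.isScalar_divVec (hg : SmoothComponents g) {X : Chart n M → E n → Fin n → ℝ}
    (hX : IsVector X) : IsScalar fun φ y => divVec g φ (X φ) y where
  smooth φ hφ := (ContDiffOn.sum fun i _ => contDiffOn_pd i φ.open_target (hX.smooth φ hφ i)).add
    (ContDiffOn.sum fun i _ => ContDiffOn.sum fun k _ =>
      (contDiffOn_christoffel hg hφ i i k).mul (hX.smooth φ hφ k))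
  transform φ hφ ψ hψ y hy := by
    have hy' := transition_mem_target hy
    have hdet := (jac_det_ne_zero g hφ hψ hy).isUnit
    -- `X` as a column vector
    set D : Chart n M → E n → Matrix (Fin n) Unit ℝ := fun φ y => Matrix.of fun i _ => X φ y i
      with hD
    -- the matrix `∇_i X^k`, with columns indexed by `i`
    set N : Chart n M → E n → Matrix (Fin n) (Fin n) ℝ := fun φ y =>
      Matrix.of fun k i => (pdMat i (D φ) y + connMat g φ y i * D φ y) k () with hN
    have htr (φ : Chart n M) (y : E n) : divVec g φ (X φ) y = (N φ y).trace := by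
      simp only [divVec, Matrix.trace, Matrix.diag, hN, of_apply, Matrix.add_apply, pdMat, hD,
        Matrix.mul_apply, connMat, Finset.sum_add_distrib]
    have hDt : ∀ z ∈ (ψ.symm.trans φ).source, D φ (φ (ψ.symm z)) = jac φ ψ z * D ψ z := by
      intro z hz
      ext j u
      exact congrFun (hX.transform φ hφ ψ hψ z hz) j
    have hDd (j : Fin n) (u : Unit) : DifferentiableAt ℝ (fun z => D φ z j u) (φ (ψ.symm y)) :=
      differentiableAt_of_contDiffOn φ.open_target (hX.smooth φ hφ j) hy'
    have h1 (i : Fin n) : jac φ ψ y * (pdMat i (D ψ) y + connMat g ψ y i * D ψ y) =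
        ∑ c, jac φ ψ y c i • (pdMat c (D φ) (φ (ψ.symm y))
          + connMat g φ (φ (ψ.symm y)) c * D φ (φ (ψ.symm y))) := by
      have h2 := pdMat_congr (ψ.symm.trans φ).open_source hy hDt i
      rw [pdMat_comp_transition hφ hψ hy hDd,
        pdMat_mul (fun a b => differentiableAt_of_contDiffOn (ψ.symm.trans φ).open_source
            (contDiffOn_jac hφ hψ a b) hy)
          (B := D ψ) (fun j u => differentiableAt_of_contDiffOn ψ.open_target (hX.smooth ψ hψ j)
            (transition_mem_source hy))] at h2
      simp only [smul_add, Finset.sum_add_distrib, h2, Matrix.mul_add, ← Matrix.mul_assoc,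
        jac_mul_connMat hg hφ hψ hy, hDt y hy, Matrix.add_mul, Matrix.sum_mul, Matrix.smul_mul]
      abel
    -- the covariant derivatives of `X` in the two charts are conjugate
    have h3 : jac φ ψ y * N ψ y = N φ (φ (ψ.symm y)) * jac φ ψ y := by
      ext k i
      have h4 := congrFun (congrFun (h1 i) k) ()
      rw [Matrix.sum_apply] at h4
      refine h4.trans (Finset.sum_congr rfl fun c _ => ?_)
      exact mul_comm _ _
    rw [htr, htr, ← Matrix.one_mul (N ψ y), ← nonsing_inv_mul _ hdet, Matrix.mul_assoc, h3,
      trace_mul_comm, Matrix.mul_assoc, mul_nonsing_inv _ hdet, Matrix.mul_one]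

lemma IsScalar.apply_chartAt {L : Chart n M → E n → ℝ} (hL : IsScalar L) {φ : Chart n M}
    (hφ : φ ∈ smoothCharts n M) {y : E n} (hy : y ∈ φ.target) :
    L (chartAt (E n) (φ.symm y)) (chartAt (E n) (φ.symm y) (φ.symm y)) = L φ y := by
  rw [hL.apply_eq (IsManifold.chart_mem_maximalAtlas (φ.symm y)) hφ (mem_chart_source _ _)
    (φ.map_target hy), φ.right_inv hy]

lemma IsScalar.smoothOnCharts {L : Chart n M → E n → ℝ} (hL : IsScalar L) :
    SmoothOnCharts (n := n) fun x => L (chartAt (E n) x) (chartAt (E n) x x) :=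
  fun φ hφ => (hL.smooth φ hφ).congr fun _ hy => hL.apply_chartAt hφ hy

end Tensors

/-! ### The Riemannian volume measure -/

section Volume

variable {n : ℕ} {M : Type*} [TopologicalSpace M]

lemma measurableSet_target_inter_preimage [MeasurableSpace M] [BorelSpace M] (φ : Chart n M) {A : Set M} (hA : MeasurableSet A) :
    MeasurableSet (φ.target ∩ φ.symm ⁻¹' A) := by
  have h1 : Measurable (φ.target.domRestrict φ.symm) :=
    (continuousOn_iff_continuous_domRestrict.1 φ.continuousOn_symm).measurable
  have h2 := φ.open_target.measurableSet.subtype_image (h1 hA)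
  convert h2 using 1
  ext y
  simp [and_comm]

variable [ChartedSpace (E n) M]

lemma SmoothOnCharts.continuous [IsManifold 𝓘(ℝ, E n) ∞ M] {f : M → ℝ}
    (hf : SmoothOnCharts (n := n) f) : Continuous f := by
  rw [continuous_iff_continuousAt]
  intro x
  set φ := chartAt (E n) x
  have hx : x ∈ φ.source := mem_chart_source _ x
  have h1 : ContinuousAt (fun y => f (φ.symm y)) (φ x) :=
    ((hf φ (IsManifold.chart_mem_maximalAtlas x)).continuousOn).continuousAt
      (φ.open_target.mem_nhds (φ.map_source hx))
  have h2 : ContinuousAt (fun z => f (φ.symm (φ z))) x :=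
    ContinuousAt.comp (f := φ) (g := fun y => f (φ.symm y)) h1 (φ.continuousAt hx)
  refine h2.congr (Filter.eventuallyEq_of_mem (φ.open_source.mem_nhds hx) fun z hz => ?_)
  simp only [φ.left_inv hz]

lemma det_fderiv_transition {φ ψ : Chart n M} (hφ : φ ∈ smoothCharts n M)
    (hψ : ψ ∈ smoothCharts n M) {y : E n} (hy : y ∈ (ψ.symm.trans φ).source) :
    (fderiv ℝ (fun z => φ (ψ.symm z)) y).det = (jac φ ψ y).det := by
  rw [ContinuousLinearMap.det,
    ← LinearMap.det_toMatrix (EuclideanSpace.basisFun (Fin n) ℝ).toBasis]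
  congr 1
  ext a i
  rw [LinearMap.toMatrix_apply]
  simp [fderiv_transition_single hφ hψ hy]

variable [IsManifold 𝓘(ℝ, E n) ∞ M] {g : Metric n M} {φ ψ : Chart n M}

lemma continuousOn_sqrt_det (hg : SmoothComponents g) (hφ : φ ∈ smoothCharts n M) :
    ContinuousOn (fun y => Real.sqrt (gLow g φ y).det) φ.target :=
  (contDiffOn_det (hg φ hφ)).continuousOn.sqrt

variable [MeasurableSpace M] [BorelSpace M]

lemma aemeasurable_chart_symm (g : Metric n M) (φ : Chart n M) :
    AEMeasurable φ.symm ((volume.restrict φ.target).withDensity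
      fun y => ENNReal.ofReal (Real.sqrt (gLow g φ y).det)) :=
  (φ.continuousOn_symm.aemeasurable φ.open_target.measurableSet).mono_ac
    (withDensity_absolutelyContinuous _ _)

lemma chartMeasure_apply (g : Metric n M) (φ : Chart n M) {A : Set M} (hA : MeasurableSet A) :
    chartMeasure g φ A =
      ∫⁻ y in φ.target ∩ φ.symm ⁻¹' A, ENNReal.ofReal (Real.sqrt (gLow g φ y).det) := by
  rw [chartMeasure, Measure.map_apply_of_aemeasurable (aemeasurable_chart_symm g φ) hA,
    withDensity_apply', Measure.restrict_restrict' φ.open_target.measurableSet, inter_comm]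

lemma chartMeasure_eq_inter_source (g : Metric n M) (φ : Chart n M) {A : Set M}
    (hA : MeasurableSet A) : chartMeasure g φ A = chartMeasure g φ (A ∩ φ.source) := by
  rw [chartMeasure_apply g φ hA, chartMeasure_apply g φ (hA.inter φ.open_source.measurableSet)]
  congr 2
  ext y
  simp only [mem_inter_iff, mem_preimage]
  exact ⟨fun h => ⟨h.1, h.2, φ.map_target h.1⟩, fun h => ⟨h.1, h.2.1⟩⟩

/-- The measures `√(det g) dx` agree on the overlaps of charts, by the change of variables
formula. -/
lemma chartMeasure_overlap (hφ : φ ∈ smoothCharts n M) (hψ : ψ ∈ smoothCharts n M)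
    {A : Set M} (hA : MeasurableSet A) (hAφ : A ⊆ φ.source) (hAψ : A ⊆ ψ.source) :
    chartMeasure g ψ A = chartMeasure g φ A := by
  rw [chartMeasure_apply g φ hA, chartMeasure_apply g ψ hA]
  set s := ψ.target ∩ ψ.symm ⁻¹' A with hs
  have hsm : MeasurableSet s := measurableSet_target_inter_preimage ψ hA
  have hss : s ⊆ (ψ.symm.trans φ).source := fun y hy => by
    simpa using ⟨hy.1, hAφ hy.2⟩
  have himage : (fun z => φ (ψ.symm z)) '' s = φ.target ∩ φ.symm ⁻¹' A := by
    ext y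
    constructor
    · rintro ⟨z, hz, rfl⟩
      exact ⟨transition_mem_target (hss hz), by
        simpa only [mem_preimage, symm_transition (hss hz)] using hz.2⟩
    · rintro ⟨hy, hyA⟩
      refine ⟨ψ (φ.symm y), ⟨ψ.map_source (hAψ hyA), ?_⟩, ?_⟩
      · simpa only [mem_preimage, ψ.left_inv (hAψ hyA)] using hyA
      · simp only [ψ.left_inv (hAψ hyA), φ.right_inv hy]
  rw [← himage, lintegral_image_eq_lintegral_abs_det_fderiv_mul volume hsm
    (fun y hy => (differentiableAt_transition hφ hψ (hss hy)).hasFDerivAt.hasFDerivWithinAt)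
    ((ψ.symm.trans φ).injOn.mono hss)]
  refine setLIntegral_congr_fun hsm fun y hy => ?_
  rw [det_fderiv_transition hφ hψ (hss hy), ← ENNReal.ofReal_mul (abs_nonneg _),
    gLow_transition g hφ hψ (hss hy), Matrix.det_mul, Matrix.det_mul, Matrix.det_transpose,
    mul_right_comm, Real.sqrt_mul (mul_self_nonneg _), Real.sqrt_mul_self_eq_abs]

/-- In the domain of a chart, the Riemannian measure is `√(det g) dx`. -/
lemma volumeMeasure_restrict_source (g : Metric n M) (hφ : φ ∈ smoothCharts n M) :
    (volumeMeasure g).restrict φ.source = chartMeasure g φ := by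
  have hms : MeasurableSet φ.source := φ.open_source.measurableSet
  have hle : ∀ ψ ∈ smoothCharts n M, chartMeasure g ψ ≤ volumeMeasure g :=
    fun ψ hψ => le_iSup₂_of_le ψ hψ le_rfl
  -- a measure above all `chartMeasure g ψ`, which is `chartMeasure g φ` in the domain of `φ`
  have hub : volumeMeasure g ≤ chartMeasure g φ + (volumeMeasure g).restrict φ.sourceᶜ := by
    refine iSup₂_le fun ψ hψ => Measure.le_iff.2 fun A hA => ?_
    rw [← measure_inter_add_sdiff A hms, Measure.add_apply, Measure.restrict_apply hA]
    refine add_le_add ?_ (hle ψ hψ _)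
    rw [chartMeasure_eq_inter_source g ψ (hA.inter hms),
      chartMeasure_overlap hφ hψ ((hA.inter hms).inter ψ.open_source.measurableSet)
        (fun x hx => hx.1.2) (fun x hx => hx.2)]
    exact measure_mono fun x hx => hx.1.1
  refine le_antisymm (Measure.le_iff.2 fun A hA => ?_) (Measure.le_iff.2 fun A hA => ?_)
  · rw [Measure.restrict_apply hA, chartMeasure_eq_inter_source g φ hA]
    refine (hub _).trans ?_
    rw [Measure.add_apply, Measure.restrict_apply (hA.inter hms), inter_assoc, inter_compl_self,
      inter_empty, measure_empty, add_zero]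
  · rw [Measure.restrict_apply hA, chartMeasure_eq_inter_source g φ hA]
    exact hle φ hφ _

lemma isLocallyFiniteMeasure_volumeMeasure (hg : SmoothComponents g) :
    IsLocallyFiniteMeasure (volumeMeasure g) := by
  refine ⟨fun x => ?_⟩
  set φ := chartAt (E n) x
  have hφ : φ ∈ smoothCharts n M := IsManifold.chart_mem_maximalAtlas x
  have hx : x ∈ φ.source := mem_chart_source _ x
  obtain ⟨K, hKn, hKt, hK⟩ := local_compact_nhds (φ.open_target.mem_nhds (φ.map_source hx))
  refine ⟨φ.source ∩ φ ⁻¹' interior K, (φ.isOpen_inter_preimage isOpen_interior).mem_nhds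
    ⟨hx, mem_interior_iff_mem_nhds.2 hKn⟩, ?_⟩
  have hm : MeasurableSet (φ.source ∩ φ ⁻¹' interior K) :=
    (φ.isOpen_inter_preimage isOpen_interior).measurableSet
  have h1 : volumeMeasure g (φ.source ∩ φ ⁻¹' interior K) =
      chartMeasure g φ (φ.source ∩ φ ⁻¹' interior K) := by
    rw [← volumeMeasure_restrict_source g hφ, Measure.restrict_apply hm, inter_right_comm,
      inter_self]
  rw [h1, chartMeasure_apply g φ hm]
  refine lt_of_le_of_lt (lintegral_mono_set (t := K) fun y hy => ?_) ?_
  · have := hy.2.2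
    rw [mem_preimage, φ.right_inv hy.1] at this
    exact interior_subset this
  · have hi : IntegrableOn (fun y => Real.sqrt (gLow g φ y).det) K :=
      ((continuousOn_sqrt_det hg hφ).mono hKt).integrableOn_compact hK
    exact (hasFiniteIntegral_iff_ofReal
      (Filter.Eventually.of_forall fun _ => Real.sqrt_nonneg _)).1 hi.2

lemma SmoothOnCharts.integrable [CompactSpace M] (hg : SmoothComponents g) {f : M → ℝ}
    (hf : SmoothOnCharts (n := n) f) : Integrable f (volumeMeasure g) := by
  have := isLocallyFiniteMeasure_volumeMeasure hg
  exact hf.continuous.integrable_of_hasCompactSupport (HasCompactSupport.of_compactSpace f)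

lemma integral_eq_integral_chart (hg : SmoothComponents g) (hφ : φ ∈ smoothCharts n M)
    {f : M → ℝ} (hf : Continuous f) (hsupp : ∀ x ∉ φ.source, f x = 0) :
    ∫ x, f x ∂(volumeMeasure g) =
      ∫ y in φ.target, Real.sqrt (gLow g φ y).det * f (φ.symm y) := by
  rw [← setIntegral_eq_integral_of_forall_compl_eq_zero (s := φ.source) hsupp,
    volumeMeasure_restrict_source g hφ, chartMeasure,
    integral_map (aemeasurable_chart_symm g φ) hf.aestronglyMeasurable,
    integral_withDensity_eq_integral_toReal_smul₀
      ((continuousOn_sqrt_det hg hφ).aemeasurable φ.open_target.measurableSet).ennreal_ofReal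
      (Filter.Eventually.of_forall fun _ => ENNReal.ofReal_lt_top)]
  simp only [ENNReal.toReal_ofReal (Real.sqrt_nonneg _), smul_eq_mul]

end Volume

/-! ### The divergence theorem -/

section EuclideanDivergence

variable {n : ℕ} {U K : Set (E n)} {f : E n → ℝ}

/-- Extension by zero of a smooth function with compact support in an open set. -/
lemma contDiff_indicator (hU : IsOpen U) (hK : IsCompact K) (hKU : K ⊆ U)
    (hf : ContDiffOn ℝ ∞ f U) (h0 : ∀ y ∈ U, y ∉ K → f y = 0) :
    ContDiff ℝ ∞ (U.indicator f) := by
  rw [contDiff_iff_contDiffAt]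
  intro y
  by_cases hy : y ∈ U
  · refine (hf.contDiffAt (hU.mem_nhds hy)).congr_of_eventuallyEq ?_
    exact Filter.eventuallyEq_of_mem (hU.mem_nhds hy) fun z hz => indicator_of_mem hz f
  · refine (contDiffAt_const (c := (0 : ℝ))).congr_of_eventuallyEq ?_
    refine Filter.eventuallyEq_of_mem (hK.isClosed.isOpen_compl.mem_nhds fun h => hy (hKU h))
      fun z hz => ?_
    by_cases hzU : z ∈ U
    · rw [indicator_of_mem hzU, h0 z hzU hz]
    · exact indicator_of_notMem hzU f

lemma hasCompactSupport_indicator (hK : IsCompact K) (h0 : ∀ y ∈ U, y ∉ K → f y = 0) :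
    HasCompactSupport (U.indicator f) := by
  refine HasCompactSupport.intro hK fun y hy => ?_
  by_cases hyU : y ∈ U
  · rw [indicator_of_mem hyU, h0 y hyU hy]
  · exact indicator_of_notMem hyU f

lemma integral_pd_eq_zero (hf : ContDiff ℝ ∞ f) (hs : HasCompactSupport f) (i : Fin n) :
    ∫ y, pd i f y = 0 := by
  have hc : Continuous fun y => fderiv ℝ f y (EuclideanSpace.single i 1) :=
    (hf.continuous_fderiv (by simp)).clm_apply continuous_const
  have hi : Integrable fun y => fderiv ℝ f y (EuclideanSpace.single i 1) :=
    hc.integrable_of_hasCompactSupport (hs.fderiv_apply ℝ _)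
  have := integral_mul_fderiv_eq_neg_fderiv_mul_of_integrable (μ := (volume : Measure (E n)))
    (f := fun _ : E n => (1 : ℝ)) (g := f) (v := EuclideanSpace.single i 1)
    (by simp) (by simpa using hi)
    (by simpa using hf.continuous.integrable_of_hasCompactSupport hs)
    (fun _ _ => differentiableAt_const _) (fun y _ => hf.differentiable (by simp) y)
  simpa [pd] using this

/-- The integral over an open set of a partial derivative of a function with compact support in
it vanishes. -/
lemma setIntegral_pd_eq_zero (hU : IsOpen U) (hK : IsCompact K) (hKU : K ⊆ U)
    (hf : ContDiffOn ℝ ∞ f U) (h0 : ∀ y ∈ U, y ∉ K → f y = 0) (i : Fin n) :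
    IntegrableOn (pd i f) U ∧ ∫ y in U, pd i f y = 0 := by
  have hsm := contDiff_indicator hU hK hKU hf h0
  have hcs := hasCompactSupport_indicator hK h0
  have heq : EqOn (pd i f) (pd i (U.indicator f)) U := fun y hy =>
    pd_congr_of_eqOn i hU hy fun z hz => (indicator_of_mem hz f).symm
  have hi : Integrable (pd i (U.indicator f)) :=
    ((hsm.continuous_fderiv (by simp)).clm_apply
      continuous_const).integrable_of_hasCompactSupport (hcs.fderiv_apply ℝ _)
  have hout : ∀ y ∉ U, pd i (U.indicator f) y = 0 := fun y hy => by
    have hz : U.indicator f =ᶠ[nhds y] fun _ => 0 :=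
      Filter.eventuallyEq_of_mem (hK.isClosed.isOpen_compl.mem_nhds fun h => hy (hKU h))
        fun z hz => by
          by_cases hzU : z ∈ U
          · simp only [indicator_of_mem hzU, h0 z hzU hz]
          · exact indicator_of_notMem hzU f
    rw [pd_congr i hz, pd_const]
  refine ⟨hi.integrableOn.congr_fun heq.symm hU.measurableSet, ?_⟩
  rw [setIntegral_congr_fun hU.measurableSet heq,
    setIntegral_eq_integral_of_forall_compl_eq_zero hout, integral_pd_eq_zero hsm hcs]

end EuclideanDivergence

section Divergence

variable {n : ℕ} {M : Type*} [TopologicalSpace M] [ChartedSpace (E n) M]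
  [IsManifold 𝓘(ℝ, E n) ∞ M] {g : Metric n M}

/-- `√(det g) div X = ∂_i (√(det g) Xⁱ)`. -/
lemma sqrt_det_mul_divVec (hg : SmoothComponents g) {φ : Chart n M} (hφ : φ ∈ smoothCharts n M)
    {y : E n} (hy : y ∈ φ.target) {X : E n → Fin n → ℝ}
    (hX : ∀ i, DifferentiableAt ℝ (fun z => X z i) y) :
    Real.sqrt (gLow g φ y).det * divVec g φ X y =
      ∑ i, pd i (fun z => Real.sqrt (gLow g φ z).det * X z i) y := by
  have hd : DifferentiableAt ℝ (fun z => Real.sqrt (gLow g φ z).det) y :=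
    (differentiableAt_of_contDiffOn φ.open_target (contDiffOn_det (hg φ hφ)) hy).sqrt
      (gLow_det_ne_zero g hφ hy)
  have h1 (i : Fin n) : pd i (fun z => Real.sqrt (gLow g φ z).det * X z i) y =
      Real.sqrt (gLow g φ y).det * pd i (fun z => X z i) y +
        Real.sqrt (gLow g φ y).det * ∑ k, christoffel g φ y k k i * X y i := by
    rw [pd_mul i hd (hX i), pd_sqrt_det hg hφ hy, ← Finset.sum_mul]
    ring
  simp only [h1, Finset.sum_add_distrib, ← Finset.mul_sum, ← mul_add, divVec]
  rw [Finset.sum_comm]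

lemma divVec_sum {ι : Type*} {s : Finset ι} {φ : Chart n M} {y : E n}
    {X : ι → E n → Fin n → ℝ} (hX : ∀ a ∈ s, ∀ i, DifferentiableAt ℝ (fun z => X a z i) y) :
    divVec g φ (fun z i => ∑ a ∈ s, X a z i) y = ∑ a ∈ s, divVec g φ (X a) y := by
  have h1 (i : Fin n) : pd i (fun z => ∑ a ∈ s, X a z i) y =
      ∑ a ∈ s, pd i (fun z => X a z i) y := pd_sum i fun a ha => hX a ha i
  simp only [divVec, h1, Finset.sum_add_distrib, Finset.mul_sum]
  congr 1
  · exact Finset.sum_comm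
  · rw [Finset.sum_comm]
    simp only [Finset.sum_comm (s := s)]
    exact Finset.sum_comm

variable [CompactSpace M] [MeasurableSpace M] [BorelSpace M]

/-- The divergence theorem for vector fields which are supported in the domain of a chart. -/
lemma integral_divVec_of_tsupport_subset (hg : SmoothComponents g) {φ : Chart n M}
    (hφ : φ ∈ smoothCharts n M) {X : Chart n M → E n → Fin n → ℝ} (hX : IsVector X) {h : M → ℝ}
    (hh : SmoothOnCharts (n := n) h) (hsupp : tsupport h ⊆ φ.source) :
    ∫ x, divVec g (chartAt (E n) x) (fun z i => h ((chartAt (E n) x).symm z) *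
      X (chartAt (E n) x) z i) (chartAt (E n) x x) ∂(volumeMeasure g) = 0 := by
  have hY := hh.isScalar.smul_vector hX
  have hdiv := hY.isScalar_divVec hg
  set Y : Chart n M → E n → Fin n → ℝ := fun φ z i => h (φ.symm z) * X φ z i with hYdef
  have hzero : ∀ x ∉ φ.source, divVec g (chartAt (E n) x) (Y (chartAt (E n) x))
      (chartAt (E n) x x) = 0 := by
    intro x hx
    set χ := chartAt (E n) x
    have hxχ : x ∈ χ.source := mem_chart_source _ x
    have hopen : IsOpen (χ.target ∩ χ.symm ⁻¹' (tsupport h)ᶜ) :=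
      χ.isOpen_inter_preimage_symm (isClosed_tsupport h).isOpen_compl
    have hmem : χ x ∈ χ.target ∩ χ.symm ⁻¹' (tsupport h)ᶜ :=
      ⟨χ.map_source hxχ, by
        simpa only [mem_preimage, mem_compl_iff, χ.left_inv hxχ] using fun h' => hx (hsupp h')⟩
    have hY0 (i : Fin n) : EqOn (fun z => Y χ z i) (fun _ => 0)
        (χ.target ∩ χ.symm ⁻¹' (tsupport h)ᶜ) := fun z hz => by
      simp only [hYdef, image_eq_zero_of_notMem_tsupport hz.2, zero_mul]
    have hY0' (i : Fin n) : Y χ (χ x) i = 0 := hY0 i hmem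
    simp only [divVec, hY0', mul_zero, Finset.sum_const_zero, add_zero]
    exact Finset.sum_eq_zero fun i _ => by
      rw [pd_congr_of_eqOn i hopen hmem (hY0 i), pd_const]
  change ∫ x, divVec g (chartAt (E n) x) (Y (chartAt (E n) x)) (chartAt (E n) x x)
    ∂(volumeMeasure g) = 0
  rw [integral_eq_integral_chart hg hφ hdiv.smoothOnCharts.continuous hzero]
  have hYd (y : E n) (hy : y ∈ φ.target) (i : Fin n) :
      DifferentiableAt ℝ (fun z => Y φ z i) y :=
    differentiableAt_of_contDiffOn φ.open_target (hY.smooth φ hφ i) hy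
  have hcongr : EqOn (fun y => Real.sqrt (gLow g φ y).det *
      divVec g (chartAt (E n) (φ.symm y)) (Y (chartAt (E n) (φ.symm y)))
        (chartAt (E n) (φ.symm y) (φ.symm y)))
      (fun y => ∑ i, pd i (fun z => Real.sqrt (gLow g φ z).det * Y φ z i) y) φ.target := by
    intro y hy
    simp only
    rw [hdiv.apply_chartAt hφ hy, sqrt_det_mul_divVec hg hφ hy (hYd y hy)]
  rw [setIntegral_congr_fun φ.open_target.measurableSet hcongr]
  have hK : IsCompact (φ '' tsupport h) :=
    (isClosed_tsupport h).isCompact.image_of_continuousOn (φ.continuousOn.mono hsupp)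
  have hKU : φ '' tsupport h ⊆ φ.target := by
    rintro _ ⟨x, hx, rfl⟩
    exact φ.map_source (hsupp hx)
  have hsqrt : ContDiffOn ℝ ∞ (fun y => Real.sqrt (gLow g φ y).det) φ.target :=
    (contDiffOn_det (hg φ hφ)).sqrt fun y hy => gLow_det_ne_zero g hφ hy
  have key (i : Fin n) := setIntegral_pd_eq_zero φ.open_target hK hKU
    (hsqrt.mul (hY.smooth φ hφ i)) (fun y hy hyK => by
      have : φ.symm y ∉ tsupport h := fun h' => hyK ⟨_, h', φ.right_inv hy⟩
      simp only [hYdef, image_eq_zero_of_notMem_tsupport this, zero_mul, mul_zero]) i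
  rw [integral_finsetSum _ fun i _ => (key i).1]
  exact Finset.sum_eq_zero fun i _ => (key i).2

/-- The divergence theorem on a compact manifold without boundary. -/
theorem integral_divVec_eq_zero [T2Space M] (hg : SmoothComponents g)
    {X : Chart n M → E n → Fin n → ℝ} (hX : IsVector X) :
    ∫ x, divVec g (chartAt (E n) x) (X (chartAt (E n) x)) (chartAt (E n) x x)
      ∂(volumeMeasure g) = 0 := by
  obtain ⟨ρ, hρ⟩ := SmoothPartitionOfUnity.exists_isSubordinate_chartAt_source
    (I := 𝓘(ℝ, E n)) (M := M)
  have hρs (a : M) : SmoothOnCharts (n := n) (ρ a) := fun φ hφ => by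
    rw [← contMDiffOn_iff_contDiffOn]
    exact ((ρ a).contMDiff.contMDiffOn (s := univ)).comp
      (contMDiffOn_symm_of_mem_maximalAtlas hφ) fun _ _ => mem_univ _
  set s : Finset M := ρ.locallyFinite.finite_nonempty_of_compact.toFinset with hs
  have hsum (x : M) : ∑ a ∈ s, ρ a x = 1 := by
    rw [← ρ.sum_eq_one (mem_univ x)]
    refine (finsum_eq_sum_of_support_subset _ fun a ha => ?_).symm
    rw [hs, Finite.coe_toFinset]
    exact ⟨x, ha⟩
  have hdecomp (x : M) : divVec g (chartAt (E n) x) (X (chartAt (E n) x)) (chartAt (E n) x x) =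
      ∑ a ∈ s, divVec g (chartAt (E n) x) (fun z i => ρ a ((chartAt (E n) x).symm z) *
        X (chartAt (E n) x) z i) (chartAt (E n) x x) := by
    have hX' : X (chartAt (E n) x) = fun z i => ∑ a ∈ s,
        ρ a ((chartAt (E n) x).symm z) * X (chartAt (E n) x) z i := by
      ext z i
      rw [← Finset.sum_mul, hsum, one_mul]
    conv_lhs => rw [hX']
    refine divVec_sum fun a _ i => ?_
    exact differentiableAt_of_contDiffOn (chartAt (E n) x).open_target
      (((hρs a).isScalar.smul_vector hX).smooth _ (IsManifold.chart_mem_maximalAtlas x) i)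
      ((chartAt (E n) x).map_source (mem_chart_source _ x))
  simp only [hdecomp]
  rw [integral_finsetSum _ fun a _ =>
    (((hρs a).isScalar.smul_vector hX).isScalar_divVec hg).smoothOnCharts.integrable hg]
  exact Finset.sum_eq_zero fun a _ => integral_divVec_of_tsupport_subset hg
    (IsManifold.chart_mem_maximalAtlas a) hX (hρs a) (hρ a)

end Divergence

/-! ### Smoothness in space and time of the geometric quantities -/

section Flow

variable {n : ℕ} {M : Type*} [TopologicalSpace M] {T : ℝ}

lemma smoothOnCylinder_cpd {f : ℝ → M → ℝ} {φ : Chart n M}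
    (hf : SmoothOnCylinder T φ.target fun s y => f s (φ.symm y)) (i : Fin n) :
    SmoothOnCylinder T φ.target fun s y => cpd φ i (f s) y :=
  SmoothOnCylinder.pd φ.open_target hf i

variable [ChartedSpace (E n) M]

lemma SmoothInSpacetime.smoothOnCylinder {f : ℝ → M → ℝ} (hf : SmoothInSpacetime (n := n) T f)
    {φ : Chart n M} (hφ : φ ∈ smoothCharts n M) :
    SmoothOnCylinder T φ.target fun s y => f s (φ.symm y) := by
  rw [SmoothOnCylinder, ← contMDiffOn_iff_contDiffOn]
  have h1 : ContMDiffOn 𝓘(ℝ, ℝ × E n) 𝓘(ℝ, ℝ) ∞ (fun p : ℝ × E n => p.1)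
      (Ico 0 T ×ˢ φ.target) := contDiff_fst.contMDiff.contMDiffOn
  have h2 : ContMDiffOn 𝓘(ℝ, ℝ × E n) 𝓘(ℝ, E n) ∞ (fun p : ℝ × E n => p.2)
      (Ico 0 T ×ˢ φ.target) := contDiff_snd.contMDiff.contMDiffOn
  have h3 : ContMDiffOn 𝓘(ℝ, ℝ × E n) 𝓘(ℝ, E n) ∞ (fun p : ℝ × E n => φ.symm p.2)
      (Ico 0 T ×ˢ φ.target) :=
    (contMDiffOn_symm_of_mem_maximalAtlas hφ).comp h2 fun p hp => hp.2
  exact hf.comp (h1.prodMk h3) fun p hp => ⟨hp.1, mem_univ _⟩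

lemma SmoothInSpacetime.smoothOnCharts {f : ℝ → M → ℝ} (hf : SmoothInSpacetime (n := n) T f)
    {t : ℝ} (ht : t ∈ Ico 0 T) : SmoothOnCharts (n := n) (f t) :=
  fun _ hφ => SmoothOnCylinder.slice (hf.smoothOnCylinder hφ) ht

/-- If `f` is smooth in space and time in all charts, then `∂_t f` is a smooth function on `M`. -/
lemma smoothOnCharts_timeDeriv {f : ℝ → M → ℝ}
    (hf : ∀ φ ∈ smoothCharts n M, SmoothOnCylinder T φ.target fun s y => f s (φ.symm y))
    {t : ℝ} (ht : t ∈ Ico 0 T) :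
    SmoothOnCharts (n := n) fun x => timeDeriv T (fun s => f s x) t :=
  fun φ hφ => SmoothOnCylinder.slice (f := fun t y => timeDeriv T (fun s => f s (φ.symm y)) t)
    (SmoothOnCylinder.timeDeriv φ.open_target (hf φ hφ)) ht

variable [IsManifold 𝓘(ℝ, E n) ∞ M] {g : ℝ → Metric n M} {Φ : ℝ → M → ℝ}
  {φ : Chart n M} {t : ℝ}

namespace IsExtendedRicciFlow

variable (hflow : IsExtendedRicciFlow T g Φ)
include hflow

lemma smoothComponents (ht : t ∈ Ico 0 T) : SmoothComponents (g t) :=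
  fun φ hφ i j => SmoothOnCylinder.slice (f := fun s y => gLow (g s) φ y i j)
    (hflow.smooth_metric φ hφ i j) ht

lemma smoothOnCylinder_gUp (hφ : φ ∈ smoothCharts n M) (i j : Fin n) :
    SmoothOnCylinder T φ.target fun s y => gUp (g s) φ y i j :=
  contDiffOn_inv_apply (A := fun p : ℝ × E n => gLow (g p.1) φ p.2)
    (hflow.smooth_metric φ hφ) (fun p hp => gLow_det_ne_zero (g p.1) hφ hp.2) i j

lemma smoothOnCylinder_christoffel (hφ : φ ∈ smoothCharts n M) (k i j : Fin n) :
    SmoothOnCylinder T φ.target fun s y => christoffel (g s) φ y k i j := by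
  have h (a b c : Fin n) := SmoothOnCylinder.pd (f := fun s y => gLow (g s) φ y b c)
    φ.open_target (hflow.smooth_metric φ hφ b c) a
  exact contDiffOn_const.mul (ContDiffOn.sum fun l _ =>
    (hflow.smoothOnCylinder_gUp hφ k l).mul (((h i j l).add (h j i l)).sub (h l i j)))

lemma smoothOnCylinder_sLow (hφ : φ ∈ smoothCharts n M) (i j : Fin n) :
    SmoothOnCylinder T φ.target fun s y => sLow (g s) (Φ s) φ y i j := by
  have hΓ := hflow.smoothOnCylinder_christoffel hφ
  have hdΓ (a k i j : Fin n) := SmoothOnCylinder.pd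
    (f := fun s y => christoffel (g s) φ y k i j) φ.open_target (hΓ k i j) a
  have hΦ (i : Fin n) := smoothOnCylinder_cpd (hflow.smooth_scalar.smoothOnCylinder hφ) i
  exact ((ContDiffOn.sum fun k _ => (hdΓ k k i j).sub (hdΓ i k k j)).add
    (ContDiffOn.sum fun k _ => ContDiffOn.sum fun l _ =>
      ((hΓ k k l).mul (hΓ l i j)).sub ((hΓ k i l).mul (hΓ l k j)))).sub ((hΦ i).mul (hΦ j))

/-- Under the flow, `∂_t g_{ij} = -2 S_{ij}`. -/
lemma timeDeriv_gLow (ht : t ∈ Ico 0 T) (hφ : φ ∈ smoothCharts n M) {y : E n}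
    (hy : y ∈ φ.target) (i j : Fin n) :
    timeDeriv T (fun s => gLow (g s) φ y i j) t = -2 * sLow (g t) (Φ t) φ y i j := by
  rw [hflow.metric_eq t ht φ hφ y hy i j, sLow]
  ring

/-- `S_{ij}` is a tensor, being a multiple of the time derivative of the metric in all time
independent coordinates. The transformation law of the Ricci tensor is not needed for this. -/
lemma isCovTensor_sLow (ht : t ∈ Ico 0 T) :
    IsCovTensor fun (φ : Chart n M) y => Matrix.of fun i j => sLow (g t) (Φ t) φ y i j where
  smooth φ hφ i j := SmoothOnCylinder.slice (f := fun s y => sLow (g s) (Φ s) φ y i j)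
    (hflow.smoothOnCylinder_sLow hφ i j) ht
  transform φ hφ ψ hψ y hy := by
    have hy' := transition_mem_target hy
    have hS (φ : Chart n M) (hφ : φ ∈ smoothCharts n M) (z : E n) (hz : z ∈ φ.target) :
        timeDerivMat T (fun s => gLow (g s) φ z) t =
          (-2 : ℝ) • Matrix.of fun i j => sLow (g t) (Φ t) φ z i j := by
      ext i j
      exact hflow.timeDeriv_gLow ht hφ hz i j
    have hd (i j : Fin n) : DifferentiableWithinAt ℝ
        (fun s => gLow (g s) φ (φ (ψ.symm y)) i j) (Ico 0 T) t :=
      differentiableWithinAt_time (f := fun s y => gLow (g s) φ y i j)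
        (hflow.smooth_metric φ hφ i j) ht hy'
    have hconst (C : Matrix (Fin n) (Fin n) ℝ) (i j : Fin n) :
        DifferentiableWithinAt ℝ (fun _ : ℝ => C i j) (Ico 0 T) t :=
      differentiableWithinAt_const _
    have hconst' (C : Matrix (Fin n) (Fin n) ℝ) : timeDerivMat T (fun _ => C) t = 0 := by
      ext i j
      simp [timeDerivMat, timeDeriv]
    have h1 : timeDerivMat T (fun s => gLow (g s) ψ y) t =
        (jac φ ψ y).transpose * timeDerivMat T (fun s => gLow (g s) φ (φ (ψ.symm y))) t
          * jac φ ψ y := by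
      have h2 : (fun s => gLow (g s) ψ y) = fun s =>
          (jac φ ψ y).transpose * (gLow (g s) φ (φ (ψ.symm y)) * jac φ ψ y) := by
        ext s : 1
        rw [gLow_transition (g s) hφ hψ hy, Matrix.mul_assoc]
      have h3 (i j : Fin n) : DifferentiableWithinAt ℝ
          (fun s => (gLow (g s) φ (φ (ψ.symm y)) * jac φ ψ y) i j) (Ico 0 T) t := by
        simp only [Matrix.mul_apply]
        exact DifferentiableWithinAt.fun_sum fun a _ => (hd i a).mul (hconst _ a j)
      rw [h2, timeDerivMat_mul ht (hconst _) h3, timeDerivMat_mul ht hd (hconst _), hconst',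
        hconst']
      simp [Matrix.mul_assoc]
    rw [hS ψ hψ y (transition_mem_source hy), hS φ hφ _ hy'] at h1
    have h4 := congrArg (fun A => (-(1 / 2) : ℝ) • A) h1
    simp only [Matrix.mul_smul, Matrix.smul_mul, smul_smul] at h4
    norm_num at h4
    exact h4

lemma isContraTensor_sUp (ht : t ∈ Ico 0 T) :
    IsContraTensor fun (φ : Chart n M) y => Matrix.of fun i j => sUp (g t) (Φ t) φ y i j where
  smooth φ hφ i j := by
    have hG := contDiffOn_gUp (hflow.smoothComponents ht) hφ
    simp only [Matrix.of_apply, sUp]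
    exact ContDiffOn.sum fun k _ => ContDiffOn.sum fun l _ =>
      ((hG i k).mul (hG j l)).mul ((hflow.isCovTensor_sLow ht).smooth φ hφ k l)
  transform φ hφ ψ hψ y hy := by
    have hmat (φ : Chart n M) (y : E n) : (Matrix.of fun i j => sUp (g t) (Φ t) φ y i j) =
        gUp (g t) φ y * (Matrix.of fun i j => sLow (g t) (Φ t) φ y i j) *
          (gUp (g t) φ y).transpose := by
      ext i j
      simp only [Matrix.of_apply, sUp, Matrix.mul_apply, Finset.sum_mul, Matrix.transpose_apply]
      rw [Finset.sum_comm]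
      exact Finset.sum_congr rfl fun k _ => Finset.sum_congr rfl fun l _ => by ring
    have h1 := (isContraTensor_gUp (hflow.smoothComponents ht)).transform φ hφ ψ hψ y hy
    have h2 := (hflow.isCovTensor_sLow ht).transform φ hφ ψ hψ y hy
    rw [hmat, hmat, h2, h1]
    simp only [Matrix.transpose_mul, Matrix.transpose_transpose, Matrix.mul_assoc]

/-- Under the flow, `∂_t g^{ij} = 2 S^{ij}`. -/
lemma timeDeriv_gUp (ht : t ∈ Ico 0 T) (hφ : φ ∈ smoothCharts n M) {y : E n}
    (hy : y ∈ φ.target) (i j : Fin n) :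
    timeDeriv T (fun s => gUp (g s) φ y i j) t = 2 * sUp (g t) (Φ t) φ y i j := by
  have h1 : timeDerivMat T (fun s => gUp (g s) φ y) t =
      -(gUp (g t) φ y * timeDerivMat T (fun s => gLow (g s) φ y) t * gUp (g t) φ y) :=
    timeDerivMat_inv ht
      (fun i j => differentiableWithinAt_time (f := fun s y => gLow (g s) φ y i j)
        (hflow.smooth_metric φ hφ i j) ht hy)
      (fun i j => differentiableWithinAt_time (f := fun s y => gUp (g s) φ y i j)
        (hflow.smoothOnCylinder_gUp hφ i j) ht hy)
      (fun s _ => gLow_det_ne_zero (g s) hφ hy)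
  have h2 := congrFun (congrFun h1 i) j
  rw [Matrix.neg_apply, Matrix.mul_apply] at h2
  refine h2.trans ?_
  simp only [Matrix.mul_apply, timeDerivMat, Matrix.of_apply, hflow.timeDeriv_gLow ht hφ hy, sUp,
    Finset.sum_mul, Finset.mul_sum, ← Finset.sum_neg_distrib]
  rw [Finset.sum_comm]
  refine Finset.sum_congr rfl fun k _ => Finset.sum_congr rfl fun l _ => ?_
  rw [gUp_symm (g t) φ y j l]
  ring

/-! ### The curvature scalar `S`, the Laplacian and `F` -/

lemma isScalar_sTrace (ht : t ∈ Ico 0 T) : IsScalar fun (φ : Chart n M) y =>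
    ∑ i, ∑ j, gUp (g t) φ y i j * sLow (g t) (Φ t) φ y i j :=
  (isContraTensor_gUp (hflow.smoothComponents ht)).contract (hflow.isCovTensor_sLow ht)

lemma smoothOnCylinder_sTrace (hφ : φ ∈ smoothCharts n M) :
    SmoothOnCylinder T φ.target fun s y => sTrace (g s) (Φ s) (φ.symm y) := by
  have h : SmoothOnCylinder T φ.target fun s y =>
      ∑ i, ∑ j, gUp (g s) φ y i j * sLow (g s) (Φ s) φ y i j :=
    ContDiffOn.sum fun i _ => ContDiffOn.sum fun j _ =>
      (hflow.smoothOnCylinder_gUp hφ i j).mul (hflow.smoothOnCylinder_sLow hφ i j)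
  exact h.congr fun p hp => (hflow.isScalar_sTrace hp.1).apply_chartAt hφ hp.2

end IsExtendedRicciFlow

lemma isScalar_divVec_grad {g : Metric n M} (hg : SmoothComponents g) {f : M → ℝ}
    (hf : SmoothOnCharts (n := n) f) :
    IsScalar fun (φ : Chart n M) y => divVec g φ (grad g φ f) y :=
  ((isContraTensor_gUp hg).mulVec hf.isCovector).isScalar_divVec hg

lemma laplacian_apply_symm {g : Metric n M} (hg : SmoothComponents g) {f : M → ℝ}
    (hf : SmoothOnCharts (n := n) f) (hφ : φ ∈ smoothCharts n M) {y : E n} (hy : y ∈ φ.target) :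
    laplacian g f (φ.symm y) = ∑ i, ∑ j, gUp g φ y i j * hessMat g φ f y i j := by
  rw [← divVec_grad hg hφ hy fun j => differentiableAt_of_contDiffOn φ.open_target
    (contDiffOn_cpd hf hφ j) hy]
  exact (isScalar_divVec_grad hg hf).apply_chartAt hφ hy

namespace IsExtendedRicciFlow

variable (hflow : IsExtendedRicciFlow T g Φ)
include hflow

lemma smoothOnCylinder_hessMat {f : ℝ → M → ℝ} (hφ : φ ∈ smoothCharts n M)
    (hf : SmoothOnCylinder T φ.target fun s y => f s (φ.symm y)) (i j : Fin n) :
    SmoothOnCylinder T φ.target fun s y => hessMat (g s) φ (f s) y i j :=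
  (SmoothOnCylinder.pd (f := fun s y => cpd φ j (f s) y) φ.open_target
    (smoothOnCylinder_cpd hf j) i).sub (ContDiffOn.sum fun k _ =>
      (hflow.smoothOnCylinder_christoffel hφ k i j).mul (smoothOnCylinder_cpd hf k))

lemma smoothOnCylinder_bigF {u : ℝ → M → ℝ} (hu : SmoothInSpacetime (n := n) T u)
    (hu_pos : ∀ t ∈ Ico 0 T, ∀ x, 0 < u t x) (a B : ℝ) (hφ : φ ∈ smoothCharts n M) :
    SmoothOnCylinder T φ.target fun s y => bigF g Φ u a B s (φ.symm y) := by
  have hus := hu.smoothOnCylinder hφ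
  have hlap : SmoothOnCylinder T φ.target fun s y => laplacian (g s) (u s) (φ.symm y) := by
    have h : SmoothOnCylinder T φ.target fun s y =>
        ∑ i, ∑ j, gUp (g s) φ y i j * hessMat (g s) φ (u s) y i j :=
      ContDiffOn.sum fun i _ => ContDiffOn.sum fun j _ =>
        (hflow.smoothOnCylinder_gUp hφ i j).mul (hflow.smoothOnCylinder_hessMat hφ hus i j)
    exact h.congr fun p hp => laplacian_apply_symm (hflow.smoothComponents hp.1)
      (hu.smoothOnCharts hp.1) hφ hp.2
  have hlog : SmoothOnCylinder T φ.target fun s y => Real.log (u s (φ.symm y)) :=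
    ContDiffOn.log hus fun p hp => (hu_pos p.1 hp.1 _).ne'
  exact (hlap.neg.add ((contDiffOn_const.mul hus).mul hlog)).add
    ((contDiffOn_const.mul (hflow.smoothOnCylinder_sTrace hφ)).mul hus)

/-- If `∂_t u = -f`, then `∂_t (∇_i ∇_j u) = -∇_i ∇_j f - (∂_t Γ^k_{ij}) ∂_k u` in coordinates. -/
lemma hasDerivWithinAt_hessMat {u f : ℝ → M → ℝ} (ht : t ∈ Ico 0 T) (hφ : φ ∈ smoothCharts n M)
    (hu : SmoothOnCylinder T φ.target fun s y => u s (φ.symm y))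
    (hut : ∀ x, timeDeriv T (fun s => u s x) t = -f t x)
    {y : E n} (hy : y ∈ φ.target) (i j : Fin n) :
    HasDerivWithinAt (fun s => hessMat (g s) φ (u s) y i j)
      (-hessMat (g t) φ (f t) y i j
        - ∑ k, timeDeriv T (fun s => christoffel (g s) φ y k i j) t * cpd φ k (u t) y)
      (Ico 0 T) t := by
  have hcpd (k : Fin n) (z : E n) (hz : z ∈ φ.target) :
      timeDeriv T (fun s => cpd φ k (u s) z) t = -cpd φ k (f t) z := by
    refine (timeDeriv_pd_comm (f := fun s y => u s (φ.symm y)) φ.open_target hu ht hz k).trans ?_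
    simp only [hut, pd_neg, cpd]
  have hpd : timeDeriv T (fun s => pd i (cpd φ j (u s)) y) t = -pd i (cpd φ j (f t)) y := by
    refine (timeDeriv_pd_comm (f := fun s y => cpd φ j (u s) y) φ.open_target
      (smoothOnCylinder_cpd hu j) ht hy i).trans ?_
    rw [pd_congr_of_eqOn i φ.open_target hy (h := fun z => -cpd φ j (f t) z)
      fun z hz => hcpd j z hz, pd_neg]
  have h1 : HasDerivWithinAt (fun s => pd i (cpd φ j (u s)) y)
      (timeDeriv T (fun s => pd i (cpd φ j (u s)) y) t) (Ico 0 T) t :=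
    (differentiableWithinAt_time (f := fun s y => pd i (cpd φ j (u s)) y)
      (SmoothOnCylinder.pd (f := fun s y => cpd φ j (u s) y) φ.open_target
        (smoothOnCylinder_cpd hu j) i) ht hy).hasDerivWithinAt
  have h2 (k : Fin n) : HasDerivWithinAt (fun s => cpd φ k (u s) y)
      (timeDeriv T (fun s => cpd φ k (u s) y) t) (Ico 0 T) t :=
    (differentiableWithinAt_time (f := fun s y => cpd φ k (u s) y)
      (smoothOnCylinder_cpd hu k) ht hy).hasDerivWithinAt
  have h3 (k : Fin n) : HasDerivWithinAt (fun s => christoffel (g s) φ y k i j)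
      (timeDeriv T (fun s => christoffel (g s) φ y k i j) t) (Ico 0 T) t :=
    (differentiableWithinAt_time (f := fun s y => christoffel (g s) φ y k i j)
      (hflow.smoothOnCylinder_christoffel hφ k i j) ht hy).hasDerivWithinAt
  have h4 := h1.sub (HasDerivWithinAt.fun_sum (u := Finset.univ) fun k _ => (h3 k).mul (h2 k))
  refine h4.congr_deriv ?_
  simp only [hpd, hcpd _ y hy, hessMat, Matrix.of_apply, Finset.sum_add_distrib, mul_neg,
    Finset.sum_neg_distrib]
  ring

/-- The evolution equation of `F`, in any chart. -/
lemma timeDeriv_bigF {u : ℝ → M → ℝ} (hu : SmoothInSpacetime (n := n) T u)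
    (hu_pos : ∀ t ∈ Ico 0 T, ∀ x, 0 < u t x) {a B : ℝ} (ht : t ∈ Ico 0 T)
    (hut : ∀ x, timeDeriv T (fun s => u s x) t = -bigF g Φ u a B t x)
    (hφ : φ ∈ smoothCharts n M) {x : M} (hx : x ∈ φ.source) :
    timeDeriv T (fun s => bigF g Φ u a B s x) t =
      laplacian (g t) (bigF g Φ u a B t) x
        - 2 * ∑ i, ∑ j, sUp (g t) (Φ t) φ (φ x) i j * hessMat (g t) φ (u t) (φ x) i j
        + dotChristoffelTerm T g φ (u t) t (φ x)
        - a * bigF g Φ u a B t x * (Real.log (u t x) + 1)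
        + B * (timeDeriv T (fun s => sTrace (g s) (Φ s) x) t * u t x)
        - B * sTrace (g t) (Φ t) x * bigF g Φ u a B t x := by
  set F := bigF g Φ u a B with hF
  have hy : φ x ∈ φ.target := φ.map_source hx
  have hxy : φ.symm (φ x) = x := φ.left_inv hx
  have hFs : SmoothOnCharts (n := n) (F t) := fun φ hφ =>
    SmoothOnCylinder.slice (hflow.smoothOnCylinder_bigF hu hu_pos a B hφ) ht
  have hud : HasDerivWithinAt (fun s => u s x) (-F t x) (Ico 0 T) t := by
    have := (differentiableWithinAt_time (hu.smoothOnCylinder hφ) ht hy).hasDerivWithinAt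
    rw [hxy] at this
    exact this.congr_deriv (hut x)
  have hSd : HasDerivWithinAt (fun s => sTrace (g s) (Φ s) x)
      (timeDeriv T (fun s => sTrace (g s) (Φ s) x) t) (Ico 0 T) t := by
    have := (differentiableWithinAt_time (hflow.smoothOnCylinder_sTrace hφ) ht
      hy).hasDerivWithinAt
    rwa [hxy] at this
  have hGd (i j : Fin n) : HasDerivWithinAt (fun s => gUp (g s) φ (φ x) i j)
      (2 * sUp (g t) (Φ t) φ (φ x) i j) (Ico 0 T) t :=
    (differentiableWithinAt_time (f := fun s y => gUp (g s) φ y i j)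
      (hflow.smoothOnCylinder_gUp hφ i j) ht hy).hasDerivWithinAt.congr_deriv
        (hflow.timeDeriv_gUp ht hφ hy i j)
  have hHd (i j : Fin n) := hflow.hasDerivWithinAt_hessMat (f := F) ht hφ
    (hu.smoothOnCylinder hφ) hut hy i j
  have hLd : HasDerivWithinAt (fun s => laplacian (g s) (u s) x)
      (2 * ∑ i, ∑ j, sUp (g t) (Φ t) φ (φ x) i j * hessMat (g t) φ (u t) (φ x) i j
        - laplacian (g t) (F t) x - dotChristoffelTerm T g φ (u t) t (φ x)) (Ico 0 T) t := by
    have h1 := HasDerivWithinAt.fun_sum (u := Finset.univ) fun i _ =>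
      HasDerivWithinAt.fun_sum (u := Finset.univ) fun j _ => (hGd i j).mul (hHd i j)
    have h2 : ∀ s ∈ Ico 0 T, laplacian (g s) (u s) x =
        ∑ i, ∑ j, gUp (g s) φ (φ x) i j * hessMat (g s) φ (u s) (φ x) i j := fun s hs => by
      conv_lhs => rw [← hxy]
      exact laplacian_apply_symm (hflow.smoothComponents hs) (hu.smoothOnCharts hs) hφ hy
    refine (h1.congr h2 (h2 t ht)).congr_deriv ?_
    have h3 := laplacian_apply_symm (hflow.smoothComponents ht) hFs hφ hy
    rw [hxy] at h3
    simp only [h3, dotChristoffelTerm, mul_sub, mul_neg, Finset.sum_add_distrib,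
      Finset.sum_sub_distrib, Finset.sum_neg_distrib, mul_assoc, ← Finset.mul_sum]
    ring
  have hlog : HasDerivWithinAt (fun s => Real.log (u s x)) (-F t x / u t x) (Ico 0 T) t :=
    hud.log (hu_pos t ht x).ne'
  have h := ((hLd.neg.add ((hud.const_mul a).mul hlog)).add ((hSd.const_mul B).mul hud))
  refine (timeDeriv_eq_of_hasDerivWithinAt ht h).trans ?_
  have hne := (hu_pos t ht x).ne'
  field_simp
  ring

end IsExtendedRicciFlow

end Flow

/-! ### Integration by parts -/

section IntegrationByParts

variable {n : ℕ} {M : Type*} [TopologicalSpace M] [ChartedSpace (E n) M]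

lemma SmoothOnCharts.mul {f h : M → ℝ} (hf : SmoothOnCharts (n := n) f)
    (hh : SmoothOnCharts (n := n) h) : SmoothOnCharts (n := n) fun x => f x * h x :=
  fun φ hφ => (hf φ hφ).mul (hh φ hφ)

lemma SmoothOnCharts.pow {f : M → ℝ} (hf : SmoothOnCharts (n := n) f) (m : ℕ) :
    SmoothOnCharts (n := n) fun x => f x ^ m :=
  fun φ hφ => (hf φ hφ).pow m

lemma SmoothOnCharts.log {f : M → ℝ} (hf : SmoothOnCharts (n := n) f) (hpos : ∀ x, 0 < f x) :
    SmoothOnCharts (n := n) fun x => Real.log (f x) :=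
  fun φ hφ => (hf φ hφ).log fun _ _ => (hpos _).ne'

lemma SmoothOnCharts.add_const {f : M → ℝ} (hf : SmoothOnCharts (n := n) f) (c : ℝ) :
    SmoothOnCharts (n := n) fun x => f x + c :=
  fun φ hφ => (hf φ hφ).add contDiffOn_const

variable [IsManifold 𝓘(ℝ, E n) ∞ M] {g : Metric n M}

lemma isVector_grad (hg : SmoothComponents g) {f : M → ℝ} (hf : SmoothOnCharts (n := n) f) :
    IsVector fun (φ : Chart n M) y => grad g φ f y :=
  (isContraTensor_gUp hg).mulVec hf.isCovector

lemma smoothOnCharts_gradSq (hg : SmoothComponents g) {f : M → ℝ}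
    (hf : SmoothOnCharts (n := n) f) : SmoothOnCharts (n := n) fun x => gradSq g f x :=
  ((isVector_grad hg hf).contract hf.isCovector).smoothOnCharts

/-- Integration by parts for the product of a power of a function and a divergence. -/
lemma integral_pow_mul_divVec [T2Space M] [CompactSpace M] [MeasurableSpace M] [BorelSpace M]
    (hg : SmoothComponents g) {f : M → ℝ} (hf : SmoothOnCharts (n := n) f)
    {X : Chart n M → E n → Fin n → ℝ} (hX : IsVector X) (m : ℕ) :
    ∫ x, f x ^ (m + 1) * divVec g (chartAt (E n) x) (X (chartAt (E n) x)) (chartAt (E n) x x)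
        ∂(volumeMeasure g) =
      -(m + 1) * ∫ x, f x ^ m * ∑ i, cpd (chartAt (E n) x) i f (chartAt (E n) x x) *
        X (chartAt (E n) x) (chartAt (E n) x x) i ∂(volumeMeasure g) := by
  have hdiv := integral_divVec_eq_zero hg ((hf.pow (m + 1)).isScalar.smul_vector hX)
  have hpt (x : M) : divVec g (chartAt (E n) x)
      (fun z i => f ((chartAt (E n) x).symm z) ^ (m + 1) * X (chartAt (E n) x) z i)
        (chartAt (E n) x x) =
      f x ^ (m + 1) * divVec g (chartAt (E n) x) (X (chartAt (E n) x)) (chartAt (E n) x x) +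
      (m + 1) * (f x ^ m * ∑ i, cpd (chartAt (E n) x) i f (chartAt (E n) x x) *
        X (chartAt (E n) x) (chartAt (E n) x x) i) := by
    set φ := chartAt (E n) x
    have hφ : φ ∈ smoothCharts n M := IsManifold.chart_mem_maximalAtlas x
    have hx : x ∈ φ.source := mem_chart_source _ x
    have hy : φ x ∈ φ.target := φ.map_source hx
    have hfd : DifferentiableAt ℝ (fun z => f (φ.symm z)) (φ x) :=
      differentiableAt_of_contDiffOn φ.open_target (hf φ hφ) hy
    rw [divVec_smul (f := fun z => f (φ.symm z) ^ (m + 1))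
      (fun i => differentiableAt_of_contDiffOn φ.open_target (hX.smooth φ hφ i) hy)
      (hfd.pow (m + 1)), φ.left_inv hx]
    congr 1
    simp only [pd_pow _ hfd, φ.left_inv hx, Finset.mul_sum, cpd]
    refine Finset.sum_congr rfl fun i _ => ?_
    push_cast
    ring
  simp only [hpt] at hdiv
  rw [integral_add ((hf.pow (m + 1)).mul (hX.isScalar_divVec hg).smoothOnCharts |>.integrable hg)
    (((hf.pow m).mul (hX.contract hf.isCovector).smoothOnCharts).integrable hg |>.const_mul _),
    integral_const_mul] at hdiv
  linear_combination hdiv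

lemma sPair_eq (g : Metric n M) (Φ f h : M → ℝ) (x : M) : sPair g Φ f h x =
    ∑ i, cpd (chartAt (E n) x) i f (chartAt (E n) x x) *
      ∑ j, sUp g Φ (chartAt (E n) x) (chartAt (E n) x x) i j *
        cpd (chartAt (E n) x) j h (chartAt (E n) x x) := by
  simp only [sPair, Finset.mul_sum, mul_assoc]

end IntegrationByParts

namespace IsExtendedRicciFlow

variable {n : ℕ} {M : Type*} [TopologicalSpace M] [ChartedSpace (E n) M]
  [IsManifold 𝓘(ℝ, E n) ∞ M] {T : ℝ} {g : ℝ → Metric n M} {Φ : ℝ → M → ℝ} {t : ℝ}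
  (hflow : IsExtendedRicciFlow T g Φ)
include hflow

/-- The vector field `S^{ij} ∇_j h`. -/
lemma isVector_sUp (ht : t ∈ Ico 0 T) {h : M → ℝ} (hh : SmoothOnCharts (n := n) h) :
    IsVector fun (φ : Chart n M) y i => ∑ j, sUp (g t) (Φ t) φ y i j * cpd φ j h y :=
  (hflow.isContraTensor_sUp ht).mulVec hh.isCovector

lemma smoothOnCharts_sPair (ht : t ∈ Ico 0 T) {f h : M → ℝ} (hf : SmoothOnCharts (n := n) f)
    (hh : SmoothOnCharts (n := n) h) :
    SmoothOnCharts (n := n) fun x => sPair (g t) (Φ t) f h x := by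
  simp only [sPair_eq]
  exact ((hflow.isVector_sUp ht hh).contract hf.isCovector).smoothOnCharts

/-- The contraction `S^{ij} ∇_i ∇_j h`. -/
lemma isScalar_sUp_hessMat (ht : t ∈ Ico 0 T) {h : M → ℝ} (hh : SmoothOnCharts (n := n) h) :
    IsScalar fun (φ : Chart n M) y =>
      ∑ i, ∑ j, sUp (g t) (Φ t) φ y i j * hessMat (g t) φ h y i j :=
  (hflow.isContraTensor_sUp ht).contract (isCovTensor_hessMat (hflow.smoothComponents ht) hh)

/-- `(∇_i S^{ij}) ∇_j h = ∇_i (S^{ij} ∇_j h) - S^{ij} ∇_i ∇_j h`. -/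
lemma divSPair_eq (ht : t ∈ Ico 0 T) {h : M → ℝ} (hh : SmoothOnCharts (n := n) h) (x : M) :
    divSPair (g t) (Φ t) h x =
      divVec (g t) (chartAt (E n) x) (fun z i => ∑ j, sUp (g t) (Φ t) (chartAt (E n) x) z i j *
        cpd (chartAt (E n) x) j h z) (chartAt (E n) x x)
      - ∑ i, ∑ j, sUp (g t) (Φ t) (chartAt (E n) x) (chartAt (E n) x x) i j *
        hessMat (g t) (chartAt (E n) x) h (chartAt (E n) x x) i j := by
  have hφ : chartAt (E n) x ∈ smoothCharts n M := IsManifold.chart_mem_maximalAtlas x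
  have hy := (chartAt (E n) x).map_source (mem_chart_source (E n) x)
  rw [divVec_mulVec (A := fun z i j => sUp (g t) (Φ t) (chartAt (E n) x) z i j)
    (fun i j => differentiableAt_of_contDiffOn (chartAt (E n) x).open_target
      ((hflow.isContraTensor_sUp ht).smooth _ hφ i j) hy)
    (fun j => differentiableAt_of_contDiffOn (chartAt (E n) x).open_target
      (contDiffOn_cpd hh hφ j) hy), add_sub_cancel_right, divSPair]

lemma smoothOnCharts_divSPair (ht : t ∈ Ico 0 T) {h : M → ℝ} (hh : SmoothOnCharts (n := n) h) :
    SmoothOnCharts (n := n) fun x => divSPair (g t) (Φ t) h x := by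
  simp only [hflow.divSPair_eq ht hh]
  exact (((hflow.isVector_sUp ht hh).isScalar_divVec (hflow.smoothComponents ht)).sub
    (hflow.isScalar_sUp_hessMat ht hh)).smoothOnCharts

end IsExtendedRicciFlow

/-- In coordinates with `g^{ij} Γ^k_{ij} = 0` the undifferentiated Christoffel symbols do not
contribute. -/
lemma fullChristoffelTerm_eq {n : ℕ} {M : Type*} [TopologicalSpace M] [ChartedSpace (E n) M]
    [IsManifold 𝓘(ℝ, E n) ∞ M] (T : ℝ) (g : ℝ → Metric n M) (φ : Chart n M) (h f : M → ℝ) (t : ℝ)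
    (y : E n) (hΓ : ∀ k, ∑ i, ∑ j, gUp (g t) φ y i j * christoffel (g t) φ y k i j = 0) :
    fullChristoffelTerm T g φ h f t y = dotChristoffelTerm T g φ h t y := by
  have h1 : ∑ i, ∑ j, ∑ k, gUp (g t) φ y i j * (christoffel (g t) φ y k i j * cpd φ k f y) = 0 := by
    have h2 (i : Fin n) : ∑ j, ∑ k, gUp (g t) φ y i j *
        (christoffel (g t) φ y k i j * cpd φ k f y) =
        ∑ k, ∑ j, gUp (g t) φ y i j * (christoffel (g t) φ y k i j * cpd φ k f y) :=
      Finset.sum_comm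
    simp only [h2]
    rw [Finset.sum_comm]
    refine Finset.sum_eq_zero fun k _ => ?_
    simp only [← mul_assoc, ← Finset.sum_mul, hΓ k, zero_mul]
  simp only [fullChristoffelTerm, dotChristoffelTerm, Finset.sum_sub_distrib, mul_sub,
    Finset.mul_sum] at h1 ⊢
  rw [h1, sub_zero]

end ExtRicci

end

theorem theorem2 {n : ℕ} {M : Type*} [TopologicalSpace M] [T2Space M] [CompactSpace M]
    [ChartedSpace (ExtRicci.E n) M] [IsManifold 𝓘(ℝ, ExtRicci.E n) ∞ M]
    [MeasurableSpace M] [BorelSpace M]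
    (T : ℝ) (g : ℝ → ExtRicci.Metric n M) (Φ u F S : ℝ → M → ℝ) (a B : ℝ)
    (hflow : ExtRicci.IsExtendedRicciFlow T g Φ)
    (hu : ExtRicci.SmoothInSpacetime (n := n) T u)
    (hu_pos : ∀ t ∈ Ico 0 T, ∀ x, 0 < u t x)
    (hS : S = fun t x => ExtRicci.sTrace (g t) (Φ t) x)
    (hF : F = ExtRicci.bigF g Φ u a B)
    (hut : ∀ t ∈ Ico 0 T, ∀ x, ExtRicci.timeDeriv T (fun s => u s x) t = -F t x)
    (t : ℝ) (ht : t ∈ Ico 0 T) (μ : Measure M) (hμ : μ = ExtRicci.volumeMeasure (g t)) :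
    -- the time derivatives exist and the integrals converge
    (∀ x, DifferentiableWithinAt ℝ (fun s => F s x) (Ico 0 T) t) ∧
    (∀ x, DifferentiableWithinAt ℝ (fun s => S s x) (Ico 0 T) t) ∧
    (∀ φ ∈ ExtRicci.smoothCharts n M, ∀ y ∈ φ.target, ∀ k i j,
      DifferentiableWithinAt ℝ (fun s => ExtRicci.christoffel (g s) φ y k i j) (Ico 0 T) t) ∧
    Integrable (fun x => F t x ^ 5 * ExtRicci.timeDeriv T (fun s => F s x) t) μ ∧
    Integrable (fun x => F t x ^ 4 * ExtRicci.gradSq (g t) (F t) x) μ ∧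
    Integrable (fun x => F t x ^ 4 * ExtRicci.sPair (g t) (Φ t) (F t) (u t) x) μ ∧
    Integrable (fun x => F t x ^ 5 * ExtRicci.divSPair (g t) (Φ t) (u t) x) μ ∧
    Integrable (fun x => F t x ^ 6 * (Real.log (u t x) + 1)) μ ∧
    Integrable (fun x => F t x ^ 6 * S t x) μ ∧
    Integrable (fun x => F t x ^ 5 * (ExtRicci.timeDeriv T (fun s => S s x) t * u t x)) μ ∧
    -- for every choice of local coordinates `κ x` around each point `x`:
    ∀ κ : M → ExtRicci.Chart n M,
      (∀ x, κ x ∈ ExtRicci.smoothCharts n M ∧ x ∈ (κ x).source) →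
      Integrable
        (fun x => F t x ^ 5 * ExtRicci.dotChristoffelTerm T g (κ x) (u t) t (κ x x)) μ ∧
      ∫ x, F t x ^ 5 * ExtRicci.timeDeriv T (fun s => F s x) t ∂μ =
        -5 * ∫ x, F t x ^ 4 * ExtRicci.gradSq (g t) (F t) x ∂μ
        + 10 * ∫ x, F t x ^ 4 * ExtRicci.sPair (g t) (Φ t) (F t) (u t) x ∂μ
        + 2 * ∫ x, F t x ^ 5 * ExtRicci.divSPair (g t) (Φ t) (u t) x ∂μ
        - a * ∫ x, F t x ^ 6 * (Real.log (u t x) + 1) ∂μ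
        - B * ∫ x, F t x ^ 6 * S t x ∂μ
        + B * ∫ x, F t x ^ 5 * (ExtRicci.timeDeriv T (fun s => S s x) t * u t x) ∂μ
        + ∫ x, F t x ^ 5 * ExtRicci.dotChristoffelTerm T g (κ x) (u t) t (κ x x) ∂μ ∧
      -- the same with the undifferentiated Christoffel symbols in the last integrand, if the
      -- coordinates `κ x` are normal (or just harmonic) at the point `x` at time `t`
      ((∀ x k, ∑ i, ∑ j, ExtRicci.gUp (g t) (κ x) (κ x x) i j *
          ExtRicci.christoffel (g t) (κ x) (κ x x) k i j = 0) →
        Integrable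
          (fun x => F t x ^ 5 *
            ExtRicci.fullChristoffelTerm T g (κ x) (u t) (F t) t (κ x x)) μ ∧
        ∫ x, F t x ^ 5 * ExtRicci.timeDeriv T (fun s => F s x) t ∂μ =
          -5 * ∫ x, F t x ^ 4 * ExtRicci.gradSq (g t) (F t) x ∂μ
          + 10 * ∫ x, F t x ^ 4 * ExtRicci.sPair (g t) (Φ t) (F t) (u t) x ∂μ
          + 2 * ∫ x, F t x ^ 5 * ExtRicci.divSPair (g t) (Φ t) (u t) x ∂μ
          - a * ∫ x, F t x ^ 6 * (Real.log (u t x) + 1) ∂μ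
          - B * ∫ x, F t x ^ 6 * S t x ∂μ
          + B * ∫ x, F t x ^ 5 * (ExtRicci.timeDeriv T (fun s => S s x) t * u t x) ∂μ
          + ∫ x, F t x ^ 5 *
              ExtRicci.fullChristoffelTerm T g (κ x) (u t) (F t) t (κ x x) ∂μ) := by
  have htd := hflow.smoothComponents ht
  have hFc : ∀ φ ∈ ExtRicci.smoothCharts n M,
      ExtRicci.SmoothOnCylinder T φ.target fun s y => F s (φ.symm y) := by
    subst hF
    exact fun φ hφ => hflow.smoothOnCylinder_bigF hu hu_pos a B hφ
  have hSc : ∀ φ ∈ ExtRicci.smoothCharts n M,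
      ExtRicci.SmoothOnCylinder T φ.target fun s y => S s (φ.symm y) := by
    subst hS
    exact fun φ hφ => hflow.smoothOnCylinder_sTrace hφ
  -- every function smooth in space and time in charts is differentiable in time at each point
  have hdiff : ∀ f : ℝ → M → ℝ, (∀ φ ∈ ExtRicci.smoothCharts n M,
      ExtRicci.SmoothOnCylinder T φ.target fun s y => f s (φ.symm y)) →
      ∀ x, DifferentiableWithinAt ℝ (fun s => f s x) (Ico 0 T) t := by
    intro f hf x
    have := ExtRicci.differentiableWithinAt_time
      (hf _ (IsManifold.chart_mem_maximalAtlas x)) ht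
      ((chartAt (ExtRicci.E n) x).map_source (mem_chart_source _ x))
    rwa [(chartAt (ExtRicci.E n) x).left_inv (mem_chart_source _ x)] at this
  have hus : ExtRicci.SmoothOnCharts (n := n) (u t) := hu.smoothOnCharts ht
  have hFs : ExtRicci.SmoothOnCharts (n := n) (F t) := fun φ hφ => (hFc φ hφ).slice ht
  have hSs : ExtRicci.SmoothOnCharts (n := n) (S t) := fun φ hφ => (hSc φ hφ).slice ht
  have hFts := ExtRicci.smoothOnCharts_timeDeriv hFc ht
  have hSts := ExtRicci.smoothOnCharts_timeDeriv hSc ht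
  have i1 := ((hFs.pow 5).mul hFts).integrable htd
  have i2 := ((hFs.pow 4).mul (ExtRicci.smoothOnCharts_gradSq htd hFs)).integrable htd
  have i3 := ((hFs.pow 4).mul (hflow.smoothOnCharts_sPair ht hFs hus)).integrable htd
  have i4 := ((hFs.pow 5).mul (hflow.smoothOnCharts_divSPair ht hus)).integrable htd
  have i5 := ((hFs.pow 6).mul ((hus.log (hu_pos t ht)).add_const 1)).integrable htd
  have i6 := ((hFs.pow 6).mul hSs).integrable htd
  have i7 := ((hFs.pow 5).mul (hSts.mul hus)).integrable htd
  subst hμ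
  refine ⟨hdiff F hFc, hdiff S hSc, fun φ hφ y hy k i j =>
    ExtRicci.differentiableWithinAt_time (hflow.smoothOnCylinder_christoffel hφ k i j) ht hy,
    i1, i2, i3, i4, i5, i6, i7, fun κ hκ => ?_⟩
  have hX := ExtRicci.isVector_grad htd hFs
  have hY := hflow.isVector_sUp ht hus
  have i8 := ((hFs.pow 5).mul (hX.isScalar_divVec htd).smoothOnCharts).integrable htd
  have i9 := ((hFs.pow 5).mul (hY.isScalar_divVec htd).smoothOnCharts).integrable htd
  have e8 := ExtRicci.integral_pow_mul_divVec htd hFs hX 4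
  have e9 := ExtRicci.integral_pow_mul_divVec htd hFs hY 4
  simp only [← ExtRicci.sPair_eq] at e9
  change _ = _ * ∫ x, F t x ^ 4 * ExtRicci.gradSq (g t) (F t) x
    ∂(ExtRicci.volumeMeasure (g t)) at e8
  -- the evolution equation of `F` in the chart `κ x`, with the invariant terms moved to the
  -- preferred chart at `x`
  have hpt : ∀ x, F t x ^ 5 * ExtRicci.dotChristoffelTerm T g (κ x) (u t) t (κ x x) =
      F t x ^ 5 * ExtRicci.timeDeriv T (fun s => F s x) t
      - F t x ^ 5 * ExtRicci.divVec (g t) (chartAt (ExtRicci.E n) x)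
          (ExtRicci.grad (g t) (chartAt (ExtRicci.E n) x) (F t)) (chartAt (ExtRicci.E n) x x)
      + 2 * (F t x ^ 5 * ExtRicci.divVec (g t) (chartAt (ExtRicci.E n) x)
          (fun z i => ∑ j, ExtRicci.sUp (g t) (Φ t) (chartAt (ExtRicci.E n) x) z i j *
            ExtRicci.cpd (chartAt (ExtRicci.E n) x) j (u t) z) (chartAt (ExtRicci.E n) x x))
      - 2 * (F t x ^ 5 * ExtRicci.divSPair (g t) (Φ t) (u t) x)
      + a * (F t x ^ 6 * (Real.log (u t x) + 1))
      + B * (F t x ^ 6 * S t x)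
      - B * (F t x ^ 5 * (ExtRicci.timeDeriv T (fun s => S s x) t * u t x)) := by
    intro x
    obtain ⟨hκx, hx⟩ := hκ x
    have h1 := hflow.timeDeriv_bigF hu hu_pos (a := a) (B := B) ht
      (fun x => by rw [hut t ht x, hF]) hκx hx
    rw [← hF, (hflow.isScalar_sUp_hessMat ht hus).apply_eq hκx
      (IsManifold.chart_mem_maximalAtlas x) hx (mem_chart_source _ x)] at h1
    rw [h1, hflow.divSPair_eq ht hus, hS]
    simp only [ExtRicci.laplacian]
    ring
  have j1 := i1.sub i8
  have j2 := j1.add (i9.const_mul 2)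
  have j3 := j2.sub (i4.const_mul 2)
  have j4 := j3.add (i5.const_mul a)
  have j5 := j4.add (i6.const_mul B)
  have j6 := j5.sub (i7.const_mul B)
  have hint : Integrable
      (fun x => F t x ^ 5 * ExtRicci.dotChristoffelTerm T g (κ x) (u t) t (κ x x))
      (ExtRicci.volumeMeasure (g t)) := by
    simp only [hpt]
    exact j6
  have hval : ∫ x, F t x ^ 5 * ExtRicci.timeDeriv T (fun s => F s x) t
        ∂(ExtRicci.volumeMeasure (g t)) =
      -5 * ∫ x, F t x ^ 4 * ExtRicci.gradSq (g t) (F t) x ∂(ExtRicci.volumeMeasure (g t))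
      + 10 * ∫ x, F t x ^ 4 * ExtRicci.sPair (g t) (Φ t) (F t) (u t) x
          ∂(ExtRicci.volumeMeasure (g t))
      + 2 * ∫ x, F t x ^ 5 * ExtRicci.divSPair (g t) (Φ t) (u t) x
          ∂(ExtRicci.volumeMeasure (g t))
      - a * ∫ x, F t x ^ 6 * (Real.log (u t x) + 1) ∂(ExtRicci.volumeMeasure (g t))
      - B * ∫ x, F t x ^ 6 * S t x ∂(ExtRicci.volumeMeasure (g t))
      + B * ∫ x, F t x ^ 5 * (ExtRicci.timeDeriv T (fun s => S s x) t * u t x)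
          ∂(ExtRicci.volumeMeasure (g t))
      + ∫ x, F t x ^ 5 * ExtRicci.dotChristoffelTerm T g (κ x) (u t) t (κ x x)
          ∂(ExtRicci.volumeMeasure (g t)) := by
    have e := integral_sub' j5 (i7.const_mul B)
    rw [integral_add' j4 (i6.const_mul B), integral_add' j3 (i5.const_mul a),
      integral_sub' j2 (i4.const_mul 2), integral_add' j1 (i9.const_mul 2),
      integral_sub' i1 i8] at e
    replace e := (integral_congr_ae (Filter.Eventually.of_forall hpt)).trans e
    simp only [integral_const_mul] at e
    norm_num at e8 e9
    rw [e8, e9] at e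
    linear_combination -e
  refine ⟨hint, hval, fun hΓ => ?_⟩
  have hfull : ∀ x, ExtRicci.fullChristoffelTerm T g (κ x) (u t) (F t) t (κ x x) =
      ExtRicci.dotChristoffelTerm T g (κ x) (u t) t (κ x x) := fun x =>
    ExtRicci.fullChristoffelTerm_eq T g (κ x) (u t) (F t) t (κ x x) (hΓ x)
  simp only [hfull]
  exact ⟨hint, hval⟩
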